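/- **Theorem 3.2.** The group $\widehat M=PGL(2,\mathbb Z)$ acts on $\mathbb Q\cup\{\infty\}$ by linear fractional transformations $z\mapsto\frac{az+b}{cz+d}$, $ad-bc=\pm1$, and every element of it has a well-defined determinant $\pm1$; let $M=PSL(2,\mathbb Z)$ be the subgroup of elements of determinant $1$. A subgroup $\widehat S\le\widehat M$ is a *Neumann subgroup* if for every $r\in\mathbb Q\cup\{\infty\}$ there is exactly one $\alpha\in\widehat S$ with $\alpha(\infty)=r$. A *system of independent generators* of a group $H$ is a set $X\subseteq H$ of elements, each of order $2$, $3$ or $\infty$, such that $H$ is the free product of the cyclic subgroups $\langle x\rangle$, $x\in X$. If $X$ has $r_2$ elements of order $2$, $r_3$ of order $3$ and $r_\infty$ of infinite order (numbers in $\{0,1,2,\dots\}\cup\{\infty\}$), we say that $H$ has $(r_2,r_3,r_\infty)$-structure. Let $\widehat S$ be a Neumann subgroup of $\widehat M$ that is not contained in $M$, and let $S=\widehat S\cap M$. Then: * $S\lhd\widehat S$, $\widehat S/S\simeq C_2$, and $\widehat S$ is never a semidirect product of $S$ and a subgroup of $\widehat S$ isomorphic to $C_2$ (that is, $S$ has no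 complement in $\widehat S$ that is isomorphic to $C_2$). * $\widehat S$ has a system of independent generators for which the following holds, where $\widehat r_2$ and $\widehat r_3$ are the numbers of its elements of order $2$ and $3$, $\widehat r_\infty^{\pm}$ is the number of its elements of infinite order and determinant $\pm1$, and $\widehat r_\infty=\widehat r_\infty^++\widehat r_\infty^-$: 1. $\widehat r_2+\widehat r_3+\widehat r_\infty=\infty$; 2. $\widehat r_\infty^-\ge1$, and if $\widehat r_\infty^+$ is finite then it is even; 3. $\widehat r_2+\widehat r_3+\frac{\widehat r_\infty^+}2\ge\widehat r_\infty^-$, and all elements of finite order in the system are elliptic (represented by a matrix $A$ with $(\operatorname{tr}A)^2<4\det A$). * For every system of independent generators of $\widehat S$, with numbers denoted in the same way, condition 1, the inequality $\widehat r_\infty^-\ge1$ and the ellipticity of the elements of finite order hold. Moreover $S$ has $(2\widehat r_2,2\widehat r_3,2\widehat r_\infty-1)$-structure, and if $S$ has $(r_2,r_3,r_\infty)$-structure then $(r_2,r_3,r_\infty)=(2\widehat r_2,2\widehat r_3,2\widehat r_\infty-1)$ (where $2\cdot\infty-1=\infty$). -/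

import Mathlib

open scoped MatrixGroups

noncomputable section

namespace ExtModular

open Matrix

/-- The image of `PSL(2, ℤ)` in `PGL(2, ℤ)`: the modular group inside the extended modular group. -/
def modularGroup : Subgroup PGL(2, ℤ) :=
  (ProjectiveSpecialLinearGroup.toPGL : PSL(2, ℤ) →* PGL(2, ℤ)).range

/-- The determinant `±1` of an element of `PGL(2, ℤ)`; it is well defined because the scalar
matrices in `GL(2, ℤ)` are `±1`, of determinant `1`. -/
def det : PGL(2, ℤ) →* ℤˣ :=
  ProjGenLinGroup.lift GeneralLinearGroup.det <| by
    ext u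
    rcases Int.units_eq_one_or u with rfl | rfl <;> simp

/-- The action of `PGL(2, ℤ)` on `ℚ ∪ {∞}` by linear fractional transformations
`z ↦ (a z + b) / (c z + d)`, with the usual conventions at `∞`. -/
def moebius : PGL(2, ℤ) →* Equiv.Perm (OnePoint ℚ) :=
  ProjGenLinGroup.lift
    ((MulAction.toPermHom (GL (Fin 2) ℚ) (OnePoint ℚ)).comp
      (GeneralLinearGroup.map (Int.castRingHom ℚ))) <| by
    ext u x
    have h00 : (GeneralLinearGroup.scalar (Fin 2) u) 0 0 = (u : ℤ) := by
      rcases Int.units_eq_one_or u with rfl | rfl <;> rfl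
    have h01 : (GeneralLinearGroup.scalar (Fin 2) u) 0 1 = 0 := by
      rcases Int.units_eq_one_or u with rfl | rfl <;> rfl
    have h10 : (GeneralLinearGroup.scalar (Fin 2) u) 1 0 = 0 := by
      rcases Int.units_eq_one_or u with rfl | rfl <;> rfl
    have h11 : (GeneralLinearGroup.scalar (Fin 2) u) 1 1 = (u : ℤ) := by
      rcases Int.units_eq_one_or u with rfl | rfl <;> rfl
    have hu : ((u : ℤ) : ℚ) ≠ 0 := by exact_mod_cast u.ne_zero
    induction x using OnePoint.rec with
    | infty => simp [OnePoint.smul_infty_eq_ite, h10]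
    | coe q => simp [OnePoint.smul_some_eq_ite, h00, h01, h10, h11, hu]

/-- A subgroup of `PGL(2, ℤ)` is a Neumann subgroup if for every `r ∈ ℚ ∪ {∞}` it contains exactly
one `α` with `α(∞) = r`. -/
def IsNeumann (S : Subgroup PGL(2, ℤ)) : Prop :=
  ∀ r : OnePoint ℚ, ∃! α : PGL(2, ℤ), α ∈ S ∧ moebius α OnePoint.infty = r

/-- An element of `PGL(2, ℤ)` is elliptic if it is represented by a matrix `A` with
`(tr A)² - 4 det A < 0`. -/
def IsElliptic (α : PGL(2, ℤ)) : Prop :=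
  ∃ A : GL (Fin 2) ℤ, ProjGenLinGroup.mk A = α ∧ A.val.IsElliptic

/-- `X` is a system of independent generators of the group `H`: every element of `X` has order
`2`, `3` or infinite order (`orderOf x = 0` means infinite order), and `H` is the free product of
the cyclic subgroups `⟨x⟩`, `x ∈ X`. -/
structure IsIndependentGenerators {H : Type*} [Group H] (X : Set H) : Prop where
  order : ∀ x ∈ X, orderOf x = 2 ∨ orderOf x = 3 ∨ orderOf x = 0
  freeProduct : Function.Bijective
    (Monoid.CoprodI.lift fun x : X => (Subgroup.zpowers (x : H)).subtype)

/-- The number, in `{0, 1, 2, …} ∪ {∞}`, of elements of `X` of order `n`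
(of infinite order if `n = 0`). -/
def numOfOrder {H : Type*} [Group H] (X : Set H) (n : ℕ) : ℕ∞ :=
  {x ∈ X | orderOf x = n}.encard

/-- The number of elements of `X` that have infinite order and determinant `ε`. -/
def numFreeOfDet {S : Subgroup PGL(2, ℤ)} (X : Set S) (ε : ℤˣ) : ℕ∞ :=
  {x ∈ X | orderOf x = 0 ∧ det (x : PGL(2, ℤ)) = ε}.encard

/-- `H` has `(r₂, r₃, r∞)`-structure: it is a free product of `r₂` groups of order `2`, `r₃` groups
of order `3` and `r∞` infinite cyclic groups. -/
def HasStructure (H : Type*) [Group H] (r₂ r₃ rinf : ℕ∞) : Prop :=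
  ∃ X : Set H, IsIndependentGenerators X ∧
    numOfOrder X 2 = r₂ ∧ numOfOrder X 3 = r₃ ∧ numOfOrder X 0 = rinf

end ExtModular

end

/-!
A Neumann subgroup `Ŝ` acts simply transitively on the cusps `ℚ ∪ {∞}`, which are the vertices of
the Farey complex: two cusps are adjacent if the determinant of their primitive vectors is `±1`, and
every edge lies in two triangles. The neighbours of `∞` are the integers, so `Ŝ` is generated by the
elements `w n` with `w n ∞ = n`, and since the complex is simply connected
(`exists_farey_potential`), the triangles give all relations between them
(`IsNeumann.isFlagSystem`).

The dual graph of the complex is a trivalent tree on which `Ŝ` acts. An element that fixes a cusp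
is trivial, so a nontrivial stabilizer of a triangle has order three and a nontrivial stabilizer of
an edge has order two. Bass–Serre theory then describes `Ŝ` as a free product of cyclic groups of
orders `2`, `3` and `∞`. Here this is proved directly: every triangle has a translate at `∞`, the
triangles at `∞` form the line `…, -1, 0, 1, …`, and walking along this line towards `0` from the
representative of least rank of each class gives a spanning tree of the quotient graph. The elements
pairing the sides of the corresponding fundamental domain form the free family; its universal
property holds because values in a group `K` on the sides outside the tree extend to a potential
along the line, whose coboundary satisfies the relations of the presentation
(`IsFlagSystem.exists_isFreeFamily`).

An element of order two of determinant `-1` is a reflection and fixes a cusp, so it cannot lie in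
`Ŝ`; all elements of order two or three of `Ŝ` are therefore elliptic of determinant `1`, and the
elements of determinant `-1` have infinite order. This excludes a complement of order two. It also
shows that some free generator `t` has determinant `-1`; multiplying the other free generators by
powers of `t` prescribes their determinants arbitrarily (`IsFreeFamily.exists_sign`). If all of them
have determinant `1`, then `S = ker det` is freely generated by `t ^ 2`, the other generators `y`
and their conjugates `t * y * t⁻¹` (`IsFreeFamily.ker`), which yields its structure; the numbers of
generators are invariants because they are the ranks of the three summands of the abelianization
(`IsFreeFamily.encard_eq`).

Infinitely many generators are needed (`IsNeumann.not_fg`). A finite set of generators would only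
relate the triangles at `∞` within some window `|n| ≤ N`. For suitable `M` no translate of the
window contains the triangle `∞, M, M + 1`, so each translate lies entirely on one side of the
geodesic from `M` to `∞`, and the relations force all translates to lie on the same side, which is
absurd. In the required system of generators one or two of the free generators get determinant `-1`,
according to the parity of the number of the others when this number is finite; all other numbers of
generators add up to `∞`, which gives the inequality.
-/

namespace ExtModular

/-! ### Free families: generators subject only to relations `x i ^ n i = 1` -/

/-- The family `x` generates `H` freely subject to the relations `x i ^ n i = 1`: it generates `H`,
satisfies these relations, and every family with the same relations in a group `K` is the image of
`x` under a homomorphism `H →* K`. The value `n i = 0` stands for a generator of infinite order. -/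
structure IsFreeFamily {I H : Type} [Group H] (x : I → H) (n : I → ℕ) : Prop where
  pow_eq_one : ∀ i, x i ^ n i = 1
  closure_range : Subgroup.closure (Set.range x) = ⊤
  exists_lift : ∀ (K : Type) [Group K] (f : I → K), (∀ i, f i ^ n i = 1) →
    ∃ φ : H →* K, ∀ i, φ (x i) = f i

namespace IsFreeFamily

variable {I H : Type} [Group H] {x : I → H} {n : I → ℕ}

/-- A generator is detected by a homomorphism to a cyclic group that kills the others. -/
lemma exists_hom_zmod (h : IsFreeFamily x n) (i : I) :
    ∃ φ : H →* Multiplicative (ZMod (n i)),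
      φ (x i) = Multiplicative.ofAdd 1 ∧ ∀ j, j ≠ i → φ (x j) = 1 := by
  classical
  obtain ⟨φ, hφ⟩ := h.exists_lift (Multiplicative (ZMod (n i)))
    (Function.update (fun _ => 1) i (Multiplicative.ofAdd 1)) (by
      intro j
      by_cases hj : j = i
      · subst hj
        simp [← ofAdd_nsmul]
      · simp [Function.update_of_ne hj])
  refine ⟨φ, by simp [hφ], fun j hj => by simp [hφ, Function.update_of_ne hj]⟩

lemma orderOf_eq (h : IsFreeFamily x n) (i : I) : orderOf (x i) = n i := by
  obtain ⟨φ, hφ, -⟩ := h.exists_hom_zmod i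
  refine Nat.dvd_antisymm (orderOf_dvd_of_pow_eq_one (h.pow_eq_one i)) ?_
  have h1 := orderOf_map_dvd φ (x i)
  rw [hφ, orderOf_ofAdd_eq_addOrderOf, ZMod.addOrderOf_one] at h1
  exact h1

lemma injective (h : IsFreeFamily x n) (hn : ∀ i, n i ≠ 1) : Function.Injective x := by
  intro i j hij
  by_contra hne
  obtain ⟨φ, hφ, hφ'⟩ := h.exists_hom_zmod i
  have h1 := hφ' j (Ne.symm hne)
  rw [← hij, hφ] at h1
  have h2 : (1 : ZMod (n i)) = 0 := h1
  have h3 := ZMod.addOrderOf_one (n i)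
  rw [h2, addOrderOf_zero] at h3
  exact hn i h3.symm

/-- The inverse of the map from the free product is given by the universal property. -/
lemma isIndependentGenerators (h : IsFreeFamily x n) (hn : ∀ i, n i = 2 ∨ n i = 3 ∨ n i = 0) :
    IsIndependentGenerators (Set.range x) := by
  refine ⟨?_, ?_, ?_⟩
  · rintro _ ⟨i, rfl⟩
    rw [h.orderOf_eq]
    exact hn i
  · have hex := h.exists_lift
      (Monoid.CoprodI fun y : Set.range x => Subgroup.zpowers (y : H))
      (fun i => Monoid.CoprodI.of (i := ⟨x i, i, rfl⟩) ⟨x i, Subgroup.mem_zpowers _⟩) (by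
        intro i
        rw [← map_pow]
        have : (⟨x i, Subgroup.mem_zpowers _⟩ : Subgroup.zpowers (x i)) ^ n i = 1 :=
          Subtype.ext (by simpa using h.pow_eq_one i)
        exact (congrArg _ this).trans (map_one _))
    let φ := hex.choose
    have hφ : ∀ i, φ (x i) = _ := hex.choose_spec
    have key : φ.comp (Monoid.CoprodI.lift
        fun y : Set.range x => (Subgroup.zpowers (y : H)).subtype) = MonoidHom.id _ := by
      refine Monoid.CoprodI.ext_hom _ _ ?_
      rintro ⟨_, i, rfl⟩
      ext ⟨g, hg⟩
      obtain ⟨k, rfl⟩ := Subgroup.mem_zpowers_iff.1 hg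
      simp only [MonoidHom.comp_apply, Monoid.CoprodI.lift_of, Subgroup.subtype_apply,
        MonoidHom.id_apply, map_zpow, hφ]
      rw [← map_zpow]
      rfl
    exact Function.LeftInverse.injective (g := φ) (fun z => DFunLike.congr_fun key z)
  · rw [← MonoidHom.range_eq_top, eq_top_iff, ← h.closure_range, Subgroup.closure_le]
    rintro _ ⟨i, rfl⟩
    exact ⟨Monoid.CoprodI.of (i := ⟨x i, i, rfl⟩) ⟨x i, Subgroup.mem_zpowers _⟩, by simp⟩

lemma numOfOrder_range (h : IsFreeFamily x n) (hn : ∀ i, n i ≠ 1) (k : ℕ) :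
    numOfOrder (Set.range x) k = {i | n i = k}.encard := by
  rw [← (h.injective hn).encard_image, numOfOrder]
  congr 1
  ext y
  constructor
  · rintro ⟨⟨i, rfl⟩, hi⟩
    exact ⟨i, by simpa [h.orderOf_eq] using hi, rfl⟩
  · rintro ⟨i, hi, rfl⟩
    exact ⟨⟨i, rfl⟩, by simpa [h.orderOf_eq] using hi⟩

lemma reindex (h : IsFreeFamily x n) {J : Type} (e : J ≃ I) :
    IsFreeFamily (x ∘ e) (n ∘ e) where
  pow_eq_one j := h.pow_eq_one _
  closure_range := by rw [e.surjective.range_comp]; exact h.closure_range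
  exists_lift K _ f hf := by
    obtain ⟨φ, hφ⟩ := h.exists_lift K (f ∘ e.symm) (fun i => by simpa using hf (e.symm i))
    exact ⟨φ, fun j => by simp [hφ]⟩

/-- The elements `x i` may be multiplied on the right by powers of a generator `x i₀` of infinite
order, as long as `i ≠ i₀` and `x i` itself is subject to no relation. -/
lemma mul_zpow (h : IsFreeFamily x n) (i₀ : I) (e : I → ℤ) (he₀ : e i₀ = 0)
    (he : ∀ i, n i ≠ 0 → e i = 0) : IsFreeFamily (fun i => x i * x i₀ ^ e i) n where
  pow_eq_one i := by
    by_cases hi : n i = 0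
    · simp [hi]
    · simpa [he i hi] using h.pow_eq_one i
  closure_range := by
    rw [eq_top_iff, ← h.closure_range, Subgroup.closure_le]
    have h0 : x i₀ ∈ Subgroup.closure (Set.range fun i => x i * x i₀ ^ e i) :=
      Subgroup.subset_closure ⟨i₀, by simp [he₀]⟩
    rintro _ ⟨i, rfl⟩
    have h1 : x i * x i₀ ^ e i ∈ Subgroup.closure (Set.range fun i => x i * x i₀ ^ e i) :=
      Subgroup.subset_closure ⟨i, rfl⟩
    simpa using mul_mem h1 (inv_mem (zpow_mem h0 (e i)))
  exists_lift K _ f hf := by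
    obtain ⟨φ, hφ⟩ := h.exists_lift K (fun i => f i * (f i₀ ^ e i)⁻¹) (fun i => by
      by_cases hi : n i = 0
      · simp [hi]
      · simpa [he i hi] using hf i)
    exact ⟨φ, fun i => by simp [hφ, he₀]⟩

end IsFreeFamily

lemma IsIndependentGenerators.isFreeFamily {H : Type} [Group H] {X : Set H}
    (h : IsIndependentGenerators X) :
    IsFreeFamily (Subtype.val : X → H) (fun x => orderOf (x : H)) where
  pow_eq_one x := pow_orderOf_eq_one _
  closure_range := by
    have h1 := MonoidHom.range_eq_top.2 h.freeProduct.2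
    rw [Monoid.CoprodI.range_eq_iSup] at h1
    rw [Subtype.range_coe, eq_top_iff, ← h1]
    refine iSup_le fun x => ?_
    rw [Subgroup.range_subtype, Subgroup.zpowers_le]
    exact Subgroup.subset_closure x.2
  exists_lift K _ f hf := by
    let e := MulEquiv.ofBijective _ h.freeProduct
    have hg : ∀ x : X, ∀ y : Subgroup.zpowers (x : H),
        y ∈ Subgroup.zpowers (⟨x, Subgroup.mem_zpowers _⟩ : Subgroup.zpowers (x : H)) := by
      rintro x ⟨y, k, rfl⟩
      exact ⟨k, Subtype.ext (by simp)⟩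
    have ho : ∀ x : X, orderOf (f x) ∣
        orderOf (⟨x, Subgroup.mem_zpowers _⟩ : Subgroup.zpowers (x : H)) := by
      intro x
      rw [Subgroup.orderOf_mk]
      exact orderOf_dvd_of_pow_eq_one (hf x)
    refine ⟨(Monoid.CoprodI.lift fun x : X =>
      monoidHomOfForallMemZpowers (hg x) (ho x)).comp e.symm.toMonoidHom, fun x => ?_⟩
    have h1 : e.symm (x : H) = Monoid.CoprodI.of (i := x) ⟨x, Subgroup.mem_zpowers _⟩ := by
      rw [MulEquiv.symm_apply_eq]
      simp [e]
    simp only [MonoidHom.comp_apply, MulEquiv.toMonoidHom_eq_coe, MonoidHom.coe_coe]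
    rw [h1, Monoid.CoprodI.lift_of, monoidHomOfForallMemZpowers_apply_gen]

/-! ### Abelianization and the invariance of the numbers of generators -/

/-- The abelianization of a free product of groups of order `2`, `3` and `∞`, written additively. -/
abbrev AbelianModel {I : Type} (n : I → ℕ) : Type :=
  ({i // n i = 2} →₀ ZMod 2) × ({i // n i = 3} →₀ ZMod 3) × ({i // n i = 0} →₀ ℤ)

lemma zmod_addMonoidHom_ext {p : ℕ} {A : Type} [AddCommGroup A] {f g : ZMod p →+ A}
    (h : f 1 = g 1) : f = g := by
  ext a
  obtain ⟨a, rfl⟩ := ZMod.intCast_surjective a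
  rw [← zsmul_one a, map_zsmul, map_zsmul, h]

open Classical in
/-- The basis vector of `AbelianModel n` with index `i`. -/
noncomputable def AbelianModel.gen {I : Type} (n : I → ℕ) (i : I) : AbelianModel n :=
  (if h2 : n i = 2 then Finsupp.single ⟨i, h2⟩ 1 else 0,
    if h3 : n i = 3 then Finsupp.single ⟨i, h3⟩ 1 else 0,
    if h0 : n i = 0 then Finsupp.single ⟨i, h0⟩ 1 else 0)

lemma AbelianModel.nsmul_gen {I : Type} {n : I → ℕ} {i : I}
    (hi : n i = 2 ∨ n i = 3 ∨ n i = 0) : n i • gen n i = 0 := by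
  rcases hi with hi | hi | hi
  · simp [gen, hi]; rfl
  · simp [gen, hi]; rfl
  · simp [gen, hi]

lemma AbelianModel.exists_hom {I A : Type} [AddCommGroup A] {n : I → ℕ} {a : I → A}
    (ha : ∀ i, n i • a i = 0) (hn : ∀ i, n i = 2 ∨ n i = 3 ∨ n i = 0) :
    ∃ G : AbelianModel n →+ A, ∀ i, G (gen n i) = a i := by
  have hz : ∀ p i, n i = p → (zmultiplesHom A (a i)) (p : ℤ) = 0 := by
    rintro _ i rfl
    simpa using ha i
  let P2 : ({i // n i = 2} →₀ ZMod 2) →+ A :=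
    Finsupp.liftAddHom fun i => ZMod.lift 2 ⟨zmultiplesHom _ (a i), hz 2 i i.2⟩
  let P3 : ({i // n i = 3} →₀ ZMod 3) →+ A :=
    Finsupp.liftAddHom fun i => ZMod.lift 3 ⟨zmultiplesHom _ (a i), hz 3 i i.2⟩
  let P0 : ({i // n i = 0} →₀ ℤ) →+ A := Finsupp.liftAddHom fun i => zmultiplesHom _ (a i)
  have e2 : ∀ i, P2 (Finsupp.single i 1) = a i := fun i => by
    have := ZMod.lift_coe 2 ⟨zmultiplesHom A (a i), hz 2 i i.2⟩ 1
    simpa [P2] using this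
  have e3 : ∀ i, P3 (Finsupp.single i 1) = a i := fun i => by
    have := ZMod.lift_coe 3 ⟨zmultiplesHom A (a i), hz 3 i i.2⟩ 1
    simpa [P3] using this
  have e0 : ∀ i, P0 (Finsupp.single i 1) = a i := fun i => by simp [P0]
  refine ⟨P2.coprod (P3.coprod P0), fun i => ?_⟩
  rcases hn i with hi | hi | hi
  · simpa [gen, hi] using e2 ⟨i, hi⟩
  · simpa [gen, hi] using e3 ⟨i, hi⟩
  · simpa [gen, hi] using e0 ⟨i, hi⟩

lemma AbelianModel.hom_ext {I A : Type} [AddCommGroup A] {n : I → ℕ} {f g : AbelianModel n →+ A}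
    (h : ∀ i, f (gen n i) = g (gen n i)) : f = g := by
  have h2 : f.comp (AddMonoidHom.inl _ _) = g.comp (AddMonoidHom.inl _ _) := by
    refine Finsupp.addHom_ext' fun i => zmod_addMonoidHom_ext ?_
    have hi : gen n i = (Finsupp.single i 1, 0) := by simp [gen, i.2]
    simpa [hi] using h i
  have h3 : (f.comp (AddMonoidHom.inr _ _)).comp (AddMonoidHom.inl _ _) =
      (g.comp (AddMonoidHom.inr _ _)).comp (AddMonoidHom.inl _ _) := by
    refine Finsupp.addHom_ext' fun i => zmod_addMonoidHom_ext ?_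
    simpa [gen, i.2] using h i
  have h0 : (f.comp (AddMonoidHom.inr _ _)).comp (AddMonoidHom.inr _ _) =
      (g.comp (AddMonoidHom.inr _ _)).comp (AddMonoidHom.inr _ _) := by
    refine Finsupp.addHom_ext' fun i => AddMonoidHom.ext_int ?_
    simpa [gen, i.2] using h i
  rw [← AddMonoidHom.coprod_unique f, ← AddMonoidHom.coprod_unique g,
    ← AddMonoidHom.coprod_unique (f.comp (AddMonoidHom.inr _ _)),
    ← AddMonoidHom.coprod_unique (g.comp (AddMonoidHom.inr _ _)), h2, h3, h0]

lemma IsFreeFamily.nonempty_abelianization_equiv {I H : Type} [Group H] {x : I → H} {n : I → ℕ}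
    (h : IsFreeFamily x n) (hn : ∀ i, n i = 2 ∨ n i = 3 ∨ n i = 0) :
    Nonempty (Additive (Abelianization H) ≃+ AbelianModel n) := by
  obtain ⟨φ, hφ⟩ := h.exists_lift (Multiplicative (AbelianModel n))
    (fun i => Multiplicative.ofAdd (AbelianModel.gen n i)) (fun i => by
      rw [← ofAdd_nsmul, AbelianModel.nsmul_gen (hn i), ofAdd_zero])
  let a : I → Additive (Abelianization H) := fun i => Additive.ofMul (Abelianization.of (x i))
  let F : Additive (Abelianization H) →+ AbelianModel n :=
    MonoidHom.toAdditiveLeft (Abelianization.lift φ)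
  have hF : ∀ i, F (a i) = AbelianModel.gen n i := hφ
  obtain ⟨G, hG⟩ := AbelianModel.exists_hom (n := n) (a := a) (fun i => by
    change Additive.ofMul (Abelianization.of (x i) ^ n i) = 0
    rw [← map_pow, h.pow_eq_one, map_one]; rfl) hn
  have h1 : ∀ y, G (F y) = y := by
    intro y
    obtain ⟨y, rfl⟩ := QuotientGroup.mk_surjective y
    change G (F (Additive.ofMul (Abelianization.of y))) = Additive.ofMul (Abelianization.of y)
    have hy : y ∈ Subgroup.closure (Set.range x) := by rw [h.closure_range]; trivial
    induction hy using Subgroup.closure_induction with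
    | mem y hy => obtain ⟨i, rfl⟩ := hy; exact (congrArg G (hF i)).trans (hG i)
    | one => simp
    | mul a b _ _ ha hb => simp only [map_mul, ofMul_mul, map_add, ha, hb]
    | inv a _ ha => simp only [map_inv, ofMul_inv, map_neg, ha]
  have h2 : F.comp G = AddMonoidHom.id _ := AbelianModel.hom_ext fun i => by
    simp [hG, hF]
  exact ⟨AddEquiv.ofBijective F ⟨Function.LeftInverse.injective (g := G) h1,
    Function.RightInverse.surjective (g := G) (DFunLike.congr_fun h2)⟩⟩

/-- The three summands of the model are its `2`-torsion, its `3`-torsion and its quotient by the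
torsion, so an isomorphism of models compares their ranks. -/
lemma AbelianModel.rank_le {I J : Type} {n : I → ℕ} {m : J → ℕ}
    (e : AbelianModel n ≃+ AbelianModel m) :
    Cardinal.mk {i // n i = 2} ≤ Cardinal.mk {j // m j = 2} ∧
    Cardinal.mk {i // n i = 3} ≤ Cardinal.mk {j // m j = 3} ∧
    Cardinal.mk {i // n i = 0} ≤ Cardinal.mk {j // m j = 0} := by
  classical
  have t2 : ∀ {L : Type} (v : L →₀ ZMod 2), (2 : ℕ) • v = 0 := fun v => by
    ext i; simp only [Finsupp.smul_apply, nsmul_eq_mul]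
    exact mul_eq_zero_of_left (by rfl) _
  have t3 : ∀ {L : Type} (v : L →₀ ZMod 3), (3 : ℕ) • v = 0 := fun v => by
    ext i; simp only [Finsupp.smul_apply, nsmul_eq_mul]
    exact mul_eq_zero_of_left (by rfl) _
  have u2 : ∀ {L : Type} (v : L →₀ ZMod 2), (3 : ℕ) • v = 0 → v = 0 := fun v hv => by
    have : v = (3 : ℕ) • v - (2 : ℕ) • v := by abel
    rw [this, hv, t2, sub_zero]
  have u3 : ∀ {L : Type} (v : L →₀ ZMod 3), (2 : ℕ) • v = 0 → v = 0 := fun v hv => by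
    have : v = (3 : ℕ) • v - (2 : ℕ) • v := by abel
    rw [this, hv, t3, sub_zero]
  have u0 : ∀ {L : Type} (k : ℕ) (_ : k ≠ 0) (v : L →₀ ℤ), k • v = 0 → v = 0 := fun k hk v hv =>
    (smul_eq_zero.1 hv).resolve_left hk
  refine ⟨?_, ?_, ?_⟩
  · let f : ({i // n i = 2} →₀ ZMod 2) →+ ({j // m j = 2} →₀ ZMod 2) :=
      (AddMonoidHom.fst _ _).comp (e.toAddMonoidHom.comp (AddMonoidHom.inl _ _))
    have hf : Function.Injective (f.toZModLinearMap 2) := by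
      refine (injective_iff_map_eq_zero f).2 fun v hv => ?_
      have h1 : (2 : ℕ) • e (v, 0, 0) = 0 := by rw [← map_nsmul]; simp [t2]
      have h2 : e (v, 0, 0) = 0 := by
        refine Prod.ext hv (Prod.ext (u3 _ ?_) (u0 2 (by simp) _ ?_))
        · exact congrArg (fun z => z.2.1) h1
        · exact congrArg (fun z => z.2.2) h1
      simpa using h2
    simpa using LinearMap.rank_le_of_injective _ hf
  · let f : ({i // n i = 3} →₀ ZMod 3) →+ ({j // m j = 3} →₀ ZMod 3) :=
      ((AddMonoidHom.fst _ _).comp (AddMonoidHom.snd _ _)).comp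
        (e.toAddMonoidHom.comp ((AddMonoidHom.inr _ _).comp (AddMonoidHom.inl _ _)))
    have hf : Function.Injective (f.toZModLinearMap 3) := by
      refine (injective_iff_map_eq_zero f).2 fun v hv => ?_
      have h1 : (3 : ℕ) • e (0, v, 0) = 0 := by rw [← map_nsmul]; simp [t3]
      have h2 : e (0, v, 0) = 0 := by
        refine Prod.ext (u2 _ ?_) (Prod.ext hv (u0 3 (by simp) _ ?_))
        · exact congrArg (fun z => z.1) h1
        · exact congrArg (fun z => z.2.2) h1
      simpa using h2
    simpa using LinearMap.rank_le_of_injective _ hf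
  · let f : ({i // n i = 0} →₀ ℤ) →+ ({j // m j = 0} →₀ ℤ) :=
      ((AddMonoidHom.snd _ _).comp (AddMonoidHom.snd _ _)).comp
        (e.toAddMonoidHom.comp ((AddMonoidHom.inr _ _).comp (AddMonoidHom.inr _ _)))
    have hf : Function.Injective f.toIntLinearMap := by
      refine (injective_iff_map_eq_zero f).2 fun v hv => ?_
      have h2 : e ((6 : ℕ) • (0, 0, v)) = 0 := by
        rw [map_nsmul]
        refine Prod.ext ?_ (Prod.ext ?_ ?_)
        · change (6 : ℕ) • (e (0, 0, v)).1 = 0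
          rw [show 6 = 3 * 2 from rfl, mul_nsmul', t2, nsmul_zero]
        · change (6 : ℕ) • (e (0, 0, v)).2.1 = 0
          rw [show 6 = 2 * 3 from rfl, mul_nsmul', t3, nsmul_zero]
        · change (6 : ℕ) • (e (0, 0, v)).2.2 = 0
          rw [show (e (0, 0, v)).2.2 = 0 from hv, nsmul_zero]
      have h3 : (6 : ℕ) • ((0, 0, v) : AbelianModel n) = 0 := by simpa using h2
      exact u0 6 (by simp) v (congrArg (fun z => z.2.2) h3)
    simpa using LinearMap.rank_le_of_injective _ hf

/-- The numbers of generators of each order do not depend on the free family. -/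
lemma IsFreeFamily.encard_eq {I J H : Type} [Group H] {x : I → H} {n : I → ℕ} {y : J → H}
    {m : J → ℕ} (hx : IsFreeFamily x n) (hy : IsFreeFamily y m)
    (hn : ∀ i, n i = 2 ∨ n i = 3 ∨ n i = 0) (hm : ∀ i, m i = 2 ∨ m i = 3 ∨ m i = 0) (k : ℕ)
    (hk : k = 2 ∨ k = 3 ∨ k = 0) : {i | n i = k}.encard = {j | m j = k}.encard := by
  obtain ⟨e⟩ := hx.nonempty_abelianization_equiv hn
  obtain ⟨e'⟩ := hy.nonempty_abelianization_equiv hm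
  have h1 := AbelianModel.rank_le (e.symm.trans e')
  have h2 := AbelianModel.rank_le (e'.symm.trans e)
  have h3 : Cardinal.mk {i // n i = k} = Cardinal.mk {j // m j = k} := by
    rcases hk with rfl | rfl | rfl
    · exact le_antisymm h1.1 h2.1
    · exact le_antisymm h1.2.1 h2.2.1
    · exact le_antisymm h1.2.2 h2.2.2
  obtain ⟨f⟩ := Cardinal.eq.1 h3
  rw [Set.encard, Set.encard]
  exact ENat.card_congr f

/-! ### The kernel of a sign homomorphism -/

/-- The action of `{1, -1}` on `K × K` in which `-1` swaps the two factors. -/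
def swapAction (K : Type) [Group K] : ℤˣ →* MulAut (K × K) where
  toFun u := if u = 1 then 1 else MulEquiv.prodComm
  map_one' := by simp
  map_mul' u v := by
    rcases Int.units_eq_one_or u with rfl | rfl <;> rcases Int.units_eq_one_or v with rfl | rfl <;>
      ext a <;> simp

@[simp]
lemma swapAction_neg_one {K : Type} [Group K] (a : K × K) : swapAction K (-1) a = (a.2, a.1) := by
  simp [swapAction]; rfl

/-- If `H` is generated by elements of `P` and `t`, and `P` is stable under conjugation by `t` and
contains `t ^ 2`, then `P` has index at most two, with cosets represented by `1` and `t⁻¹`. -/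
lemma mem_or_mem_of_closure {H : Type} [Group H] {X : Set H} (hX : Subgroup.closure X = ⊤)
    {P : Subgroup H} {t : H} (ht2 : t ^ 2 ∈ P) (hconj : ∀ p ∈ P, t * p * t⁻¹ ∈ P)
    (hmem : ∀ x ∈ X, x ∈ P ∨ x = t) (g : H) : g ∈ P ∨ t * g ∈ P := by
  have hg : g ∈ Subgroup.closure X := by rw [hX]; trivial
  have hconj' : ∀ p ∈ P, t⁻¹ * p * t ∈ P := fun p hp => by
    have h1 := mul_mem (mul_mem (inv_mem ht2) (hconj p hp)) ht2
    convert h1 using 1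
    group
  induction hg using Subgroup.closure_induction with
  | mem x hx =>
    rcases hmem x hx with h | rfl
    · exact Or.inl h
    · exact Or.inr (by simpa [pow_two] using ht2)
  | one => exact Or.inl (one_mem P)
  | mul a b _ _ ha hb =>
    rcases ha with ha | ha <;> rcases hb with hb | hb
    · exact Or.inl (mul_mem ha hb)
    · refine Or.inr ?_
      have := mul_mem (hconj a ha) hb
      convert this using 1
      group
    · refine Or.inr ?_
      have := mul_mem ha hb
      convert this using 1
      group
    · refine Or.inl ?_
      have := mul_mem (inv_mem ht2) (mul_mem (hconj _ ha) hb)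
      convert this using 1
      group
  | inv a _ ha =>
    rcases ha with ha | ha
    · exact Or.inl (inv_mem ha)
    · refine Or.inr ?_
      have := mul_mem ht2 (hconj' _ (inv_mem ha))
      convert this using 1
      group

/-- If `H` is freely generated by `t` and elements `y i` lying in the kernel of a homomorphism
`d` to `{1, -1}` with `d t = -1`, then this kernel is freely generated by `t ^ 2`, the `y i` and
their conjugates `t * y i * t⁻¹`. -/
lemma IsFreeFamily.ker {I H : Type} [Group H] {x : Option I → H} {n : Option I → ℕ}
    (h : IsFreeFamily x n) (hn : n none = 0) (d : H →* ℤˣ) (hd : d (x none) = -1)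
    (hd' : ∀ i, d (x (some i)) = 1) :
    ∃ y : Option (I ⊕ I) → d.ker,
      IsFreeFamily y fun j => j.elim 0 (Sum.elim (fun i => n (some i)) fun i => n (some i)) := by
  set t := x none with ht
  have hd2 : d (t ^ 2) = 1 := by simp [hd]
  have hdc : ∀ i, d (t * x (some i) * t⁻¹) = 1 := fun i => by simp [hd, hd']
  let y : Option (I ⊕ I) → d.ker := fun j => j.elim ⟨t ^ 2, hd2⟩
    (Sum.elim (fun i => ⟨x (some i), hd' i⟩) fun i => ⟨t * x (some i) * t⁻¹, hdc i⟩)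
  refine ⟨y, ?_, ?_, ?_⟩
  · rintro (_ | i | i)
    · simp
    · exact Subtype.ext (h.pow_eq_one (some i))
    · refine Subtype.ext ?_
      change (t * x (some i) * t⁻¹) ^ n (some i) = 1
      rw [conj_pow, h.pow_eq_one, mul_one, mul_inv_cancel]
  · let P : Subgroup H := (Subgroup.closure (Set.range y)).map d.ker.subtype
    have hyP : ∀ j, (y j : H) ∈ P := fun j => ⟨y j, Subgroup.subset_closure ⟨j, rfl⟩, rfl⟩
    have ht2 : t ^ 2 ∈ P := hyP none
    have hP : P = Subgroup.closure (Set.range fun j => (y j : H)) := by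
      simp only [P, MonoidHom.map_closure, ← Set.range_comp]; rfl
    have hconj : ∀ p ∈ P, t * p * t⁻¹ ∈ P := by
      intro p hp
      rw [hP] at hp
      induction hp using Subgroup.closure_induction with
      | mem p hp =>
        obtain ⟨j, rfl⟩ := hp
        rcases j with _ | i | i
        · convert ht2 using 1
          change t * t ^ 2 * t⁻¹ = _
          group
        · exact hyP (some (Sum.inr i))
        · have h1 := mul_mem (mul_mem ht2 (hyP (some (Sum.inl i)))) (inv_mem ht2)
          convert h1 using 1
          change t * (t * x (some i) * t⁻¹) * t⁻¹ = t ^ 2 * x (some i) * (t ^ 2)⁻¹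
          rw [pow_two]
          group
      | one => simp
      | mul a b _ _ ha hb =>
        convert mul_mem ha hb using 1
        group
      | inv a _ ha =>
        convert inv_mem ha using 1
        group
    rw [eq_top_iff]
    rintro ⟨s, hs⟩ -
    have h2 := mem_or_mem_of_closure h.closure_range ht2 hconj (by
      rintro _ ⟨_ | i, rfl⟩
      · exact Or.inr rfl
      · exact Or.inl (hyP (some (Sum.inl i)))) s
    rcases h2 with ⟨s', hs', h3⟩ | ⟨s', hs', h3⟩
    · have : s' = ⟨s, hs⟩ := Subtype.ext h3
      rwa [← this]
    · have h4 : d (t * s) = 1 := by rw [← h3]; exact s'.2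
      rw [map_mul, hd, show d s = 1 from hs] at h4
      simp at h4
  · intro K _ f hf
    -- `x (some i)` is sent to the pair of the values prescribed for it and its conjugate by `t`;
    -- conjugation by `t` swaps the two, so the first component has the prescribed values
    obtain ⟨Φ, hΦ⟩ := h.exists_lift ((K × K) ⋊[swapAction K] ℤˣ)
      (fun j => j.elim (SemidirectProduct.inl (1, f none) * SemidirectProduct.inr (-1))
        fun i => SemidirectProduct.inl (f (some (Sum.inl i)), f (some (Sum.inr i)))) (by
      rintro (_ | i)
      · simp [hn]
      · change SemidirectProduct.inl _ ^ n (some i) = 1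
        rw [← map_pow, Prod.pow_mk, show f (some (Sum.inl i)) ^ n (some i) = 1 from hf _,
          show f (some (Sum.inr i)) ^ n (some i) = 1 from hf (some (Sum.inr i))]
        exact map_one _)
    have hright : ∀ s, (Φ s).right = d s := by
      refine DFunLike.congr_fun (f := SemidirectProduct.rightHom.comp Φ) (g := d) ?_
      refine MonoidHom.eq_of_eqOn_dense h.closure_range ?_
      rintro _ ⟨_ | i, rfl⟩
      · have hΦt : Φ t = _ := hΦ none
        simp [← ht, hΦt, hd]
      · simp [hΦ, hd']
    refine ⟨⟨⟨fun s => (Φ s).left.1, by simp⟩, fun a b => ?_⟩, ?_⟩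
    · have ha : (Φ a).right = 1 := (hright a).trans a.2
      simp [ha]
    · have hΦt : Φ t = _ := hΦ none
      rintro (_ | i | i)
      · change (Φ (t ^ 2)).left.1 = _
        simp [pow_two, hΦt]
      · change (Φ (x (some i))).left.1 = _
        simp [hΦ]
      · change (Φ (t * x (some i) * t⁻¹)).left.1 = _
        simp [hΦ, hΦt]

/-! ### Counting generators and prescribing their signs -/

lemma IsFreeFamily.mulEquiv {I H H' : Type} [Group H] [Group H'] {x : I → H} {n : I → ℕ}
    (h : IsFreeFamily x n) (e : H ≃* H') : IsFreeFamily (e ∘ x) n where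
  pow_eq_one i := by simp [← map_pow, h.pow_eq_one]
  closure_range := by
    have := congrArg (Subgroup.map e.toMonoidHom) h.closure_range
    rw [MonoidHom.map_closure, ← Set.range_comp, Subgroup.map_top_of_surjective _ e.surjective]
      at this
    exact this
  exists_lift K _ f hf := by
    obtain ⟨φ, hφ⟩ := h.exists_lift K f hf
    exact ⟨φ.comp e.symm.toMonoidHom, fun i => by simp [hφ]⟩

lemma IsFreeFamily.hasStructure {I H : Type} [Group H] {x : I → H} {n : I → ℕ}
    (h : IsFreeFamily x n) (hn : ∀ i, n i = 2 ∨ n i = 3 ∨ n i = 0) :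
    HasStructure H {i | n i = 2}.encard {i | n i = 3}.encard {i | n i = 0}.encard := by
  have hn1 : ∀ i, n i ≠ 1 := fun i => by have := hn i; omega
  exact ⟨_, h.isIndependentGenerators hn, h.numOfOrder_range hn1 2, h.numOfOrder_range hn1 3,
    h.numOfOrder_range hn1 0⟩

lemma numOfOrder_eq_encard {H : Type} [Group H] (X : Set H) (k : ℕ) :
    numOfOrder X k = {x : X | orderOf (x : H) = k}.encard := by
  rw [← Subtype.val_injective.encard_image, numOfOrder]
  congr 1
  ext y
  simp [and_comm]

/-- The numbers of independent generators of order `2`, `3` and `∞` are invariants of the group. -/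
lemma HasStructure.unique {H : Type} [Group H] {r₂ r₃ r s₂ s₃ s : ℕ∞}
    (h : HasStructure H r₂ r₃ r) (h' : HasStructure H s₂ s₃ s) : r₂ = s₂ ∧ r₃ = s₃ ∧ r = s := by
  obtain ⟨X, hX, rfl, rfl, rfl⟩ := h
  obtain ⟨Y, hY, rfl, rfl, rfl⟩ := h'
  have key : ∀ k : ℕ, k = 2 ∨ k = 3 ∨ k = 0 → numOfOrder X k = numOfOrder Y k := fun k hk => by
    rw [numOfOrder_eq_encard, numOfOrder_eq_encard]
    exact hX.isFreeFamily.encard_eq hY.isFreeFamily (fun x => hX.order x x.2)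
      (fun y => hY.order y y.2) k hk
  exact ⟨key 2 (by simp), key 3 (by simp), key 0 (by simp)⟩

lemma encard_setOf_option {J : Type} (p : Option J → Prop) [Decidable (p none)] :
    {o | p o}.encard = {j | p (some j)}.encard + if p none then 1 else 0 := by
  have h1 : {o | p o} = some '' {j | p (some j)} ∪ {o | o = none ∧ p none} := by
    ext (_ | j) <;> simp
  have h2 : Disjoint (some '' {j | p (some j)}) {o | o = none ∧ p none} := by
    rw [Set.disjoint_left]
    rintro _ ⟨j, -, rfl⟩ ⟨h, -⟩
    simp at h
  rw [h1, Set.encard_union_eq h2, (Option.some_injective J).encard_image]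
  congr 1
  split_ifs with h
  · simp [h]
  · simp [h]

lemma encard_setOf_sum {J L : Type} (p : J ⊕ L → Prop) :
    {o | p o}.encard = {j | p (Sum.inl j)}.encard + {j | p (Sum.inr j)}.encard := by
  have h1 : {o | p o} = Sum.inl '' {j | p (Sum.inl j)} ∪ Sum.inr '' {j | p (Sum.inr j)} := by
    ext (_ | j) <;> simp
  have h2 : Disjoint (Sum.inl '' {j | p (Sum.inl j)}) (Sum.inr '' {j | p (Sum.inr j)}) := by
    rw [Set.disjoint_left]
    rintro _ ⟨j, -, rfl⟩ ⟨i, -, h⟩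
    simp at h
  rw [h1, Set.encard_union_eq h2, Sum.inl_injective.encard_image, Sum.inr_injective.encard_image]

section Sign

variable {I H : Type} [Group H] {x : I → H} {n : I → ℕ} {d : H →* ℤˣ}

lemma IsFreeFamily.exists_neg (h : IsFreeFamily x n) (hd : d ≠ 1) : ∃ i, d (x i) = -1 := by
  by_contra! hne
  refine hd (MonoidHom.eq_of_eqOn_dense h.closure_range ?_)
  rintro _ ⟨i, rfl⟩
  exact (Int.units_eq_one_or _).resolve_right (hne i)

/-- Generators of finite order have sign `1`, provided that all involutions do. -/
lemma IsFreeFamily.sign_eq_one (h : IsFreeFamily x n) (hn : ∀ i, n i = 2 ∨ n i = 3 ∨ n i = 0)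
    (htor : ∀ g, orderOf g = 2 → d g = 1) {i : I} (hi : n i ≠ 0) : d (x i) = 1 := by
  rcases hn i with h2 | h3 | h0
  · exact htor _ (by rw [h.orderOf_eq, h2])
  · have h1 := h.pow_eq_one i
    rw [h3] at h1
    have h4 := congrArg d h1
    rcases Int.units_eq_one_or (d (x i)) with h5 | h5
    · exact h5
    · rw [map_pow, h5, map_one] at h4
      exact absurd h4 (by decide)
  · exact absurd h0 hi

lemma IsFreeFamily.eq_zero_of_neg (h : IsFreeFamily x n) (hn : ∀ i, n i = 2 ∨ n i = 3 ∨ n i = 0)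
    (htor : ∀ g, orderOf g = 2 → d g = 1) {i : I} (hi : d (x i) = -1) : n i = 0 := by
  by_contra h0
  rw [h.sign_eq_one hn htor h0] at hi
  exact absurd hi (by decide)

/-- Once some free generator has sign `-1`, the signs of the other generators of infinite order can
be prescribed arbitrarily. -/
lemma IsFreeFamily.exists_sign (h : IsFreeFamily x n) (hn : ∀ i, n i = 2 ∨ n i = 3 ∨ n i = 0)
    (htor : ∀ g, orderOf g = 2 → d g = 1) {i₀ : I} (hi₀ : d (x i₀) = -1)
    (σ : I → ℤˣ) (hσ : σ i₀ = -1) (hσ1 : ∀ i, n i ≠ 0 → σ i = 1) :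
    ∃ y : I → H, IsFreeFamily y n ∧ ∀ i, d (y i) = σ i := by
  classical
  refine ⟨_, h.mul_zpow i₀ (fun i => if d (x i) = σ i then 0 else 1) (by simp [hi₀, hσ]) ?_, ?_⟩
  · intro i hi
    have : d (x i) = σ i := by
      rw [hσ1 i hi]
      exact h.sign_eq_one hn htor hi
    simp [this]
  · intro i
    by_cases hi : d (x i) = σ i
    · simp [hi]
    · simp only [hi, if_false, zpow_one, map_mul, hi₀]
      rcases Int.units_eq_one_or (d (x i)) with h1 | h1 <;>
        rcases Int.units_eq_one_or (σ i) with h2 | h2 <;> simp_all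

/-- The structure of the index two subgroup `ker d`: the free generator of sign `-1` contributes one
free generator, every other generator contributes two of its order. -/
lemma IsFreeFamily.hasStructure_ker (h : IsFreeFamily x n)
    (hn : ∀ i, n i = 2 ∨ n i = 3 ∨ n i = 0) (hd : d ≠ 1)
    (htor : ∀ g, orderOf g = 2 → d g = 1) :
    HasStructure d.ker (2 * {i | n i = 2}.encard) (2 * {i | n i = 3}.encard)
      (2 * {i | n i = 0}.encard - 1) := by
  classical
  obtain ⟨i₀, hi₀⟩ := h.exists_neg hd
  have hn₀ := h.eq_zero_of_neg hn htor hi₀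
  obtain ⟨y, hy, hσ⟩ := h.exists_sign hn htor hi₀ (fun i => if i = i₀ then -1 else 1) (by simp)
    (fun i hi => by
      have : i ≠ i₀ := by rintro rfl; exact hi hn₀
      simp [this])
  let e : Option {i // i ≠ i₀} ≃ I := Equiv.optionSubtypeNe i₀
  have he : e none = i₀ := by simp [e]
  have he' : ∀ i : {i // i ≠ i₀}, e (some i) = i := fun i => by simp [e]
  obtain ⟨z, hz⟩ := (hy.reindex e).ker (by simp [he, hn₀]) d (by simp [he, hσ])
    (fun i => by simp [he', hσ, i.2])
  have key := hz.hasStructure (by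
    rintro (_ | i | i)
    · simp
    · exact hn _
    · exact hn _)
  have count : ∀ k, {i | n i = k}.encard =
      {i : {i // i ≠ i₀} | n i = k}.encard + if k = 0 then 1 else 0 := by
    intro k
    have h1 : {i | n i = k} = e '' {o | n (e o) = k} := by
      ext i
      constructor
      · intro hi
        exact ⟨e.symm i, by simpa using hi, by simp⟩
      · rintro ⟨o, ho, rfl⟩
        exact ho
    rw [h1, e.injective.encard_image, encard_setOf_option]
    simp [he, he', hn₀, eq_comm]
  simp only [encard_setOf_option, encard_setOf_sum] at key
  simp only [Option.elim, Sum.elim_inl, Sum.elim_inr, Function.comp, he'] at key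
  simp only [count]
  convert key using 1
  · simp [two_mul]
  · simp [two_mul]
  · simp only [if_true]
    generalize Set.encard _ = a
    induction a using ENat.recTopCoe with
    | top => simp
    | coe a =>
      norm_cast
      omega

end Sign

/-- A set containing `i₀` has a subset `B` containing `i₀` with at most two elements such that
`Z \ B` is infinite or has an even number of elements; only the finiteness of `B` is recorded. -/
lemma exists_finite_subset_even_diff {I : Type} {Z : Set I} {i₀ : I} (hi₀ : i₀ ∈ Z) :
    ∃ B ⊆ Z, i₀ ∈ B ∧ B.Finite ∧ ∀ k : ℕ, (Z \ B).encard = k → Even k := by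
  by_cases hodd : ∀ k : ℕ, (Z \ {i₀}).encard = k → Even k
  · exact ⟨{i₀}, by simpa using hi₀, rfl, Set.finite_singleton _, hodd⟩
  · push Not at hodd
    obtain ⟨k, hk, hk'⟩ := hodd
    have hne : (Z \ {i₀}).Nonempty := by
      rw [← Set.encard_ne_zero, hk]
      rintro h0
      rw [Nat.cast_eq_zero] at h0
      simp [h0] at hk'
    obtain ⟨i₁, hi₁, hi₁'⟩ := hne
    refine ⟨{i₀, i₁}, by rintro _ (rfl | rfl) <;> assumption, by simp, by simp, fun l hl => ?_⟩
    have h1 : Z \ {i₀, i₁} = (Z \ {i₀}) \ {i₁} := by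
      ext; simp; tauto
    have h2 := Set.encard_sdiff_singleton_add_one (s := Z \ {i₀}) (a := i₁) ⟨hi₁, hi₁'⟩
    rw [← h1, hl, hk] at h2
    have h3 : l + 1 = k := by exact_mod_cast h2
    rw [← h3] at hk'
    simpa [Nat.even_add_one] using hk'

/-! ### Flags at a cusp -/

/-- A function defined by recursion on the rank: the solution of `h r = A r * h (p r)`
that is `1` where `p` does not decrease the rank. -/
def descent {α H : Type} [Group H] (rk : α → ℕ) (p : α → α) (A : α → H) (r : α) : H :=
  if _ : rk (p r) < rk r then A r * descent rk p A (p r) else 1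
termination_by rk r

/-- A flag at `∞` consists of a triangle `∞, n, n + 1` and one of its edges `∞, n + s` with
`s ∈ {0, 1}`, and is encoded by the integer `2 * n + s`. The involution `turn`, which swaps `2 * n`
and `2 * n + 1`, passes to the other edge at `∞` of the same triangle. -/
def turn (f : ℤ) : ℤ := if f % 2 = 0 then f + 1 else f - 1

/-- The involution swapping `2 * n - 1` and `2 * n`: it passes from a flag at `∞` to the other
triangle with the same edge. -/
def cross (f : ℤ) : ℤ := if f % 2 = 0 then f - 1 else f + 1

/-- Position of a flag in the enumeration `0, -1, 1, -2, 2, …`. Repeatedly passing to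
the flag of smaller rank of the same triangle and then to the next triangle leads to `0`. -/
def rank (f : ℤ) : ℕ := if 0 ≤ f then (2 * f).toNat else (-2 * f - 1).toNat

@[simp] lemma turn_turn (f : ℤ) : turn (turn f) = f := by grind [turn]

@[simp] lemma cross_cross (f : ℤ) : cross (cross f) = f := by grind [cross]

lemma cross_ne (f : ℤ) : cross f ≠ f := by grind [cross]

lemma cross_turn_ne (f : ℤ) : cross (turn f) ≠ turn (cross f) := by grind [turn, cross]

lemma rank_injective : Function.Injective rank := by
  intro f g h
  simp only [rank] at h
  split_ifs at h <;> omega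

lemma rank_cross_lt {f : ℤ} (h0 : f ≠ 0) (h : rank f ≤ rank (turn f)) :
    rank (cross f) < rank f := by
  simp only [rank, turn, cross] at h ⊢
  split_ifs at h ⊢ <;> omega

/-- Along the two-sided path `…, -1, 0, 1, …`, increments across the edges `{2 * n - 1, 2 * n}`
can be prescribed. -/
lemma exists_path_potential {K : Type} [Group K] (a : ℤ → K)
    (ha : ∀ f, a (cross f) = (a f)⁻¹) :
    ∃ c : ℤ → K, c 0 = 1 ∧ (∀ f, c (turn f) = c f) ∧ ∀ f, c (cross f) = c f * a f := by
  let b : ℤ → K := fun n => a (2 * n - 1)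
  let p : Equiv.Perm (ℤ × K) :=
    { toFun := fun z => (z.1 + 1, z.2 * b (z.1 + 1))
      invFun := fun z => (z.1 - 1, z.2 * (b z.1)⁻¹)
      left_inv := fun z => by simp
      right_inv := fun z => by simp }
  have h1 : ∀ n : ℤ, ((p ^ n) (0, 1)).1 = n := by
    intro n
    induction n using Int.induction_on with
    | zero => simp
    | succ n ih =>
      rw [add_comm, zpow_add, zpow_one, Equiv.Perm.mul_apply]
      change ((p ^ (n : ℤ)) (0, 1)).1 + 1 = _
      rw [ih, add_comm]
    | pred n ih =>
      rw [sub_eq_add_neg, add_comm, zpow_add, zpow_neg_one, Equiv.Perm.mul_apply]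
      change ((p ^ (-n : ℤ)) (0, 1)).1 - 1 = _
      rw [ih]; ring
  let c' : ℤ → K := fun n => ((p ^ n) (0, 1)).2
  have h2 : ∀ n, c' (n + 1) = c' n * b (n + 1) := by
    intro n
    simp only [c']
    rw [add_comm n 1, zpow_add, zpow_one, Equiv.Perm.mul_apply]
    change _ * b (_ + 1) = _
    rw [h1, add_comm]
  refine ⟨fun f => c' (f / 2), by simp [c'], fun f => ?_, fun f => ?_⟩
  · have h3 : turn f / 2 = f / 2 := by
      simp only [turn]
      split_ifs <;> omega
    simp only [h3]
  · by_cases hf : f % 2 = 0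
    · obtain ⟨n, rfl⟩ : ∃ n, f = 2 * n := ⟨f / 2, by omega⟩
      have e1 : cross (2 * n) = 2 * n - 1 := by simp [cross]
      have e2 : (2 * n - 1) / 2 = n - 1 := by omega
      have e3 : 2 * n / 2 = n := by omega
      have h3 := h2 (n - 1)
      have h4 : b n = (a (2 * n))⁻¹ := by rw [← ha, e1]
      rw [sub_add_cancel] at h3
      simp only [e1, e2, e3, h3, h4]
      simp
    · obtain ⟨n, rfl⟩ : ∃ n, f = 2 * n + 1 := ⟨f / 2, by omega⟩
      have e1 : cross (2 * n + 1) = 2 * (n + 1) := by simp [cross]; omega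
      have e2 : (2 * (n + 1)) / 2 = n + 1 := by omega
      have e3 : (2 * n + 1) / 2 = n := by omega
      have h4 : b (n + 1) = a (2 * n + 1) := congrArg a (by ring)
      simp only [e1, e2, e3, h2, h4]

/-- The combinatorics of a group `H` acting simply transitively on the cusps, seen from
`∞`. The element `w f` takes `∞` to the other end of the edge of the flag `f`. The inverse of `w f`
takes this other end to `∞`, and the triangle and edge of `f` to the triangle and edge of the flag `σ f`.
The fields `closure_range` and `exists_lift` state that `H` is presented by the generators `w f`
with the relations `w_cross`, `w_invol` and `w_turn`; the last is the relation of a triangle. -/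
structure IsFlagSystem {H : Type} [Group H] (σ : ℤ → ℤ) (w : ℤ → H) : Prop where
  invol : ∀ f, σ (σ f) = f
  ne : ∀ f, σ f ≠ f
  comm : ∀ f, σ (cross f) = cross (σ f)
  braid : ∀ f, σ (turn (σ f)) = turn (σ (turn f))
  w_cross : ∀ f, w (cross f) = w f
  w_invol : ∀ f, w (σ f) = (w f)⁻¹
  w_turn : ∀ f, w (turn f) = w f * w (turn (σ f))
  closure_range : Subgroup.closure (Set.range w) = ⊤
  exists_lift : ∀ (K : Type) [Group K] (k : ℤ → K), (∀ f, k (cross f) = k f) →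
    (∀ f, k (σ f) = (k f)⁻¹) → (∀ f, k (turn f) = k f * k (turn (σ f))) →
    ∃ φ : H →* K, ∀ f, φ (w f) = k f

/-- `Transport σ w f v f'` means that `v` takes the triangle of the flag `f'` to the triangle of the
flag `f`, in the combinatorics of a flag system: the triangle is preserved by `turn`, and `w f`
takes the triangle of `σ f` to that of `f`. -/
inductive Transport {H : Type} [Group H] (σ : ℤ → ℤ) (w : ℤ → H) (f : ℤ) : H → ℤ → Prop
  | refl : Transport σ w f 1 f
  | step_turn {v : H} {f' : ℤ} : Transport σ w f v f' → Transport σ w f v (turn f')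
  | step_invol {v : H} {f' : ℤ} : Transport σ w f v f' → Transport σ w f (v * w f') (σ f')

namespace Transport

variable {H : Type} [Group H] {σ : ℤ → ℤ} {w : ℤ → H} {f f' f'' : ℤ} {v v' : H}

lemma trans (h : Transport σ w f v f') (h' : Transport σ w f' v' f'') :
    Transport σ w f (v * v') f'' := by
  induction h' with
  | refl => simpa using h
  | step_turn _ ih => exact ih.step_turn
  | step_invol _ ih => rw [← mul_assoc]; exact ih.step_invol

lemma symm (hw : IsFlagSystem σ w) (h : Transport σ w f v f') : Transport σ w f' v⁻¹ f := by
  induction h with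
  | refl => simpa using Transport.refl
  | @step_turn v f' _ ih =>
    have h1 : Transport σ w (turn f') 1 f' := by
      simpa using (Transport.refl (σ := σ) (w := w) (f := turn f')).step_turn
    simpa using h1.trans ih
  | @step_invol v f' _ ih =>
    have h1 : Transport σ w (σ f') (w f')⁻¹ f' := by
      simpa [hw.invol, hw.w_invol] using (Transport.refl (σ := σ) (w := w) (f := σ f')).step_invol
    simpa using h1.trans ih

/-- A triangle has six flags. -/
lemma cases_six (hw : IsFlagSystem σ w) (h : Transport σ w f v f') :
    (f' = f ∧ v = 1) ∨ (f' = turn f ∧ v = 1) ∨ (f' = σ f ∧ v = w f) ∨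
    (f' = turn (σ f) ∧ v = w f) ∨
    (f' = σ (turn f) ∧ v = w (turn f)) ∨
    (f' = turn (σ (turn f)) ∧ v = w (turn f)) := by
  have hwt := hw.w_turn f
  have hwt' := hw.w_turn (turn f)
  rw [turn_turn] at hwt'
  have hb := hw.braid f
  have hb' := hw.braid (turn f)
  rw [turn_turn] at hb'
  induction h with
  | refl => simp
  | step_turn _ ih =>
    rcases ih with ⟨rfl, rfl⟩ | ⟨rfl, rfl⟩ | ⟨rfl, rfl⟩ | ⟨rfl, rfl⟩ | ⟨rfl, rfl⟩ | ⟨rfl, rfl⟩ <;>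
      simp
  | step_invol _ ih =>
    rcases ih with ⟨rfl, rfl⟩ | ⟨rfl, rfl⟩ | ⟨rfl, rfl⟩ | ⟨rfl, rfl⟩ | ⟨rfl, rfl⟩ | ⟨rfl, rfl⟩
    · simp
    · simp
    · simp [hw.invol, hw.w_invol]
    · simp [hb, ← hwt]
    · simp [hw.invol, hw.w_invol]
    · simp [hb', ← hwt']

/-- If no rotation of order three preserves the triangle of `f` (such a rotation exists exactly if
`σ f = turn f`), then the transport of `f` to itself is trivial. -/
lemma eq_one (hw : IsFlagSystem σ w) (hf : σ f ≠ turn f) (h : Transport σ w f v f) :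
    v = 1 := by
  rcases h.cases_six hw with ⟨-, h⟩ | ⟨-, h⟩ | ⟨h, -⟩ | ⟨h, -⟩ | ⟨h, -⟩ | ⟨h, -⟩
  · exact h
  · exact h
  · exact absurd h.symm (hw.ne f)
  · exact absurd (by rw [h, turn_turn, ← h]) hf
  · exact absurd (by rw [← hw.invol (turn f), ← h]) hf
  · have h1 : σ (turn f) = turn f := by
      rw [← turn_turn (σ (turn f)), ← h]
    exact absurd h1 (hw.ne _)

end Transport

/-! ### Classes of triangles and a fundamental domain -/

section

variable {H : Type} [Group H] {σ : ℤ → ℤ} {w : ℤ → H}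

/-- The flag `r` has the smallest rank among the flags at `∞` of the translates of its triangle. -/
def IsRep (σ : ℤ → ℤ) (w : ℤ → H) (r : ℤ) : Prop :=
  ∀ v f', Transport σ w r v f' → rank r ≤ rank f'

namespace IsFlagSystem

variable (hw : IsFlagSystem σ w)
include hw

/-- The condition `σ f = turn f` says that a rotation of order three preserves the triangle of `f`,
so it also holds for the other flag at `∞` of this triangle. -/
lemma fixed_turn {f : ℤ} (hf : σ f = turn f) : σ (turn f) = turn (turn f) := by
  rw [← hf, hw.invol, hf, turn_turn]

/-- Two adjacent triangles are not both preserved by rotations of order three. -/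
lemma not_fixed_cross {f : ℤ} (hf : σ f = turn f) : σ (cross f) ≠ turn (cross f) := by
  rw [hw.comm, hf]
  exact cross_turn_ne f

lemma not_fixed_invol {f : ℤ} (hf : σ f ≠ turn f) : σ (σ f) ≠ turn (σ f) := by
  intro h
  rw [hw.invol] at h
  exact hf (by rw [h, turn_turn, ← h])

lemma transport_unique {f f' : ℤ} {v v' : H} (hf : σ f ≠ turn f) (h : Transport σ w f v f')
    (h' : Transport σ w f v' f') : v = v' := by
  have := (h.trans (h'.symm hw)).eq_one hw hf
  rwa [mul_inv_eq_one] at this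

lemma eq_or_eq_turn {f f' : ℤ} {v : H} (hf : σ f = turn f) (h : Transport σ w f v f') :
    f' = f ∨ f' = turn f := by
  have h1 := hw.fixed_turn hf
  rw [turn_turn] at h1
  rcases h.cases_six hw with ⟨h, -⟩ | ⟨h, -⟩ | ⟨h, -⟩ | ⟨h, -⟩ | ⟨h, -⟩ | ⟨h, -⟩ <;>
    simp [h, hf, h1]

/-- A choice of representatives of the triangle classes and of transports to them. -/
lemma exists_rep : ∃ (r : ℤ → ℤ) (v : ℤ → H), (∀ f, Transport σ w f (v f) (r f)) ∧
    (∀ f, IsRep σ w (r f)) ∧ (∀ f f' u, Transport σ w f u f' → r f = r f') ∧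
    (∀ f, σ f = turn f → v f = 1) ∧ ∀ f, IsRep σ w f → r f = f := by
  have h1 : ∀ f, ∃ r, ∃ v, Transport σ w f v r ∧ IsRep σ w r ∧ (σ f = turn f → v = 1) := by
    intro f
    obtain ⟨r, ⟨v, hv⟩, hr⟩ := (measure rank).wf.has_min {r | ∃ v, Transport σ w f v r}
      ⟨f, 1, Transport.refl⟩
    have hmin : IsRep σ w r := fun u f' hu => not_lt.1 (hr f' ⟨v * u, hv.trans hu⟩)
    by_cases hc : σ f = turn f
    · have h1 : Transport σ w f 1 r := by
        rcases hw.eq_or_eq_turn hc hv with rfl | rfl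
        · exact Transport.refl
        · exact Transport.refl.step_turn
      exact ⟨r, 1, h1, hmin, fun _ => rfl⟩
    · exact ⟨r, v, hv, hmin, fun h => absurd h hc⟩
  choose r v h2 h3 h4 using h1
  have h5 : ∀ f f' u, Transport σ w f u f' → r f = r f' := by
    intro f f' u hu
    have h6 := (((h2 f).symm hw).trans hu).trans (h2 f')
    exact rank_injective (le_antisymm (h3 f _ _ h6) (h3 f' _ _ (h6.symm hw)))
  refine ⟨r, v, h2, h3, h5, h4, fun f hf => ?_⟩
  exact rank_injective (le_antisymm (h3 f _ _ ((h2 f).symm hw)) (hf _ _ (h2 f)))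

/-- A gauge for a fundamental domain: `(g f)⁻¹` takes the triangle of `f` to a triangle that depends
only on its class. By the last condition, the fundamental domain formed by these triangles is
connected along the edges of the spanning tree. An edge of a triangle with a rotation of order three
is not used for this purpose; there, the gauge changes by the rotation itself. -/
lemma exists_gauge : ∃ g : ℤ → H, g 0 = 1 ∧ (∀ f, g (turn f) = g f) ∧
    (∀ f, σ f ≠ turn f → w f * g (σ f) = g f) ∧
    (∀ f, σ f = turn f → w f = g f * (g (cross f))⁻¹) ∧
    ∀ f, IsRep σ w f → f ≠ 0 → σ f ≠ turn f → σ (cross f) ≠ turn (cross f) →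
      g f = g (cross f) := by
  classical
  obtain ⟨r, v, htr, hrep, hcl, hv1, hr⟩ := hw.exists_rep
  -- at the representative of a class, `g` is defined by its value at the next triangle towards `0`,
  -- with a factor `δ` if one of these two triangles has a rotation of order three
  let δ : ℤ → H := fun f => if σ f = turn f then w f else
    if σ (cross f) = turn (cross f) then (w f)⁻¹ else 1
  let h : ℤ → H := descent rank (fun f => r (cross f)) fun f => δ f * v (cross f)
  let g : ℤ → H := fun f => v f * h (r f)
  have hg_rep : ∀ f, IsRep σ w f → g f = h f := by
    intro f hf
    have h1 : v f = 1 := by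
      by_cases hc : σ f = turn f
      · exact hv1 f hc
      · have := htr f
        rw [hr f hf] at this
        exact this.eq_one hw hc
    simp only [g, h1, hr f hf, one_mul]
  have hg_step : ∀ f, IsRep σ w f → f ≠ 0 → g f = δ f * g (cross f) := by
    intro f hf h0
    have h1 : rank (cross f) < rank f :=
      rank_cross_lt h0 (hf (1 : H) _ Transport.refl.step_turn)
    have h2 : rank (r (cross f)) < rank f :=
      lt_of_le_of_lt (hrep (cross f) _ _ ((htr (cross f)).symm hw)) h1
    rw [hg_rep f hf]
    simp only [h, g]
    rw [descent, dif_pos h2, mul_assoc]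
  have G1 : ∀ f, g (turn f) = g f := by
    intro f
    have h1 : Transport σ w f 1 (turn f) := Transport.refl.step_turn
    have h2 : v (turn f) = v f := by
      by_cases hc : σ f = turn f
      · rw [hv1 f hc, hv1 _ (hw.fixed_turn hc)]
      · have h3 := h1.trans (htr (turn f))
        rw [← hcl f _ _ h1, one_mul] at h3
        exact hw.transport_unique hc h3 (htr f)
    simp only [g, h2, hcl f _ _ h1]
  have G2 : ∀ f, σ f ≠ turn f → w f * g (σ f) = g f := by
    intro f hc
    have h1 : Transport σ w f (w f) (σ f) := by
      simpa using (Transport.refl (σ := σ) (w := w) (f := f)).step_invol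
    have h3 := h1.trans (htr (σ f))
    rw [← hcl f _ _ h1] at h3
    simp only [g, ← hcl f _ _ h1, ← mul_assoc, hw.transport_unique hc h3 (htr f)]
  have hrep0 : IsRep σ w 0 := fun _ _ _ => by simp [rank]
  have G0 : g 0 = 1 := by
    rw [hg_rep 0 hrep0]
    simp only [h]
    rw [descent, dif_neg (by simp [rank])]
  have G3rep : ∀ f, IsRep σ w f → σ f = turn f → w f = g f * (g (cross f))⁻¹ := by
    intro f hf hc
    by_cases h0 : f = 0
    · subst h0
      have hm : IsRep σ w (cross 0) := by
        intro u f' hu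
        by_contra hlt
        have h1 : f' = 0 := by
          simp only [rank, cross] at hlt
          split_ifs at hlt <;> omega
        rw [h1] at hu
        rcases hw.eq_or_eq_turn hc (hu.symm hw) with h2 | h2
        · simp [cross] at h2
        · simp [cross, turn] at h2
      have h2 := hg_step (cross 0) hm (by simp [cross])
      simp only [δ, hw.not_fixed_cross hc, cross_cross, hc, if_true, if_false, hw.w_cross, G0,
        mul_one] at h2
      rw [h2, G0]
      simp
    · rw [hg_step f hf h0]
      simp [δ, hc]
  have G3 : ∀ f, σ f = turn f → w f = g f * (g (cross f))⁻¹ := by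
    intro f hc
    rcases hw.eq_or_eq_turn hc (htr f) with h1 | h1
    · exact G3rep f (h1 ▸ hrep f) hc
    · obtain ⟨s, rfl⟩ : ∃ s, f = turn s := ⟨turn f, by simp⟩
      rw [turn_turn] at h1
      have hs : IsRep σ w s := h1 ▸ hrep (turn s)
      have hcs : σ s = turn s := by simpa using hw.fixed_turn hc
      have e1 := G3rep s hs hcs
      have e2 := G2 (cross s) (hw.not_fixed_cross hcs)
      have e3 : σ (cross s) = cross (turn s) := by rw [hw.comm, hcs]
      have e4 := hw.w_turn s
      have e5 := hw.w_invol s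
      rw [hcs, turn_turn] at e4
      rw [hcs] at e5
      rw [e3, hw.w_cross] at e2
      rw [G1, e4]
      rw [eq_mul_inv_iff_mul_eq] at e1 ⊢
      rw [mul_assoc, e2, e1]
  refine ⟨g, G0, G1, G2, G3, fun f hf h0 hc hc' => ?_⟩
  rw [hg_step f hf h0]
  simp [δ, hc, hc']

end IsFlagSystem

end

/-! ### Classes of edges and the spanning tree -/

section

variable {H : Type} [Group H] {σ : ℤ → ℤ} {w : ℤ → H}

/-- The edges of the flags `f` and `f'` are translates of each other. -/
def SameEdge (σ : ℤ → ℤ) (f f' : ℤ) : Prop :=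
  f' = f ∨ f' = cross f ∨ f' = σ f ∨ f' = σ (cross f)

/-- One of the two triangles at the edge of `f` admits a rotation of order three. -/
def TouchesFixed (σ : ℤ → ℤ) (f : ℤ) : Prop :=
  σ f = turn f ∨ σ (cross f) = turn (cross f)

/-- The edge of `f` belongs to the spanning tree: up to translation it is the edge through which the
representative of some class of triangles is left towards the triangle of the flag `0`. Edges of
triangles with a rotation of order three are excluded, as they carry a generator of order three. -/
def IsTreeEdge (σ : ℤ → ℤ) (w : ℤ → H) (f : ℤ) : Prop :=
  ¬ TouchesFixed σ f ∧ ∃ f', SameEdge σ f f' ∧ IsRep σ w f' ∧ f' ≠ 0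

lemma turn_ne_cross (f : ℤ) : turn f ≠ cross f := by grind [turn, cross]

open Classical in
/-- The order of the generator attached to an edge outside the spanning tree, with `0` for infinite
order. It is `2` if some element of the group swaps the ends of the edge and the two triangles at
the edge, which means that `σ f = cross f`. -/
noncomputable def edgeOrder (σ : ℤ → ℤ) (f : ℤ) : ℕ :=
  if TouchesFixed σ f then 3 else if σ f = cross f then 2 else 0

lemma edgeOrder_mem (σ : ℤ → ℤ) (f : ℤ) :
    edgeOrder σ f = 2 ∨ edgeOrder σ f = 3 ∨ edgeOrder σ f = 0 := by
  unfold edgeOrder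
  split_ifs <;> simp

/-- The conditions on the increments `a f`, from the triangle of `f` to that of `cross f`, of a
potential that defines a homomorphism on the group of the flag system. -/
structure IsIncrement {K : Type} [Group K] (σ : ℤ → ℤ) (w : ℤ → H) (a : ℤ → K) : Prop where
  cross : ∀ f, a (cross f) = (a f)⁻¹
  invol : ∀ f, ¬ TouchesFixed σ f → a (σ f) = a f
  invol_fixed : ∀ f, TouchesFixed σ f → a (σ f) = (a f)⁻¹
  cube : ∀ f, TouchesFixed σ f → a f ^ 3 = 1
  tree : ∀ f, IsTreeEdge σ w f → a f = 1

namespace IsFlagSystem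

variable (hw : IsFlagSystem σ w)
include hw

lemma sameEdge_equivalence : Equivalence (SameEdge σ) where
  refl f := Or.inl rfl
  symm {f f'} h := by
    rcases h with rfl | rfl | rfl | rfl <;>
      simp [SameEdge, hw.invol, hw.comm]
  trans {f f' f''} h h' := by
    rcases h with rfl | rfl | rfl | rfl <;> rcases h' with rfl | rfl | rfl | rfl <;>
      simp [SameEdge, hw.invol, hw.comm]

lemma touchesFixed_congr {f f' : ℤ} (h : SameEdge σ f f') :
    TouchesFixed σ f ↔ TouchesFixed σ f' := by
  have h1 : ∀ f, σ (σ f) = turn (σ f) ↔ σ f = turn f := fun f => by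
    refine ⟨fun h => by_contra fun h' => hw.not_fixed_invol h' h, fun h => ?_⟩
    rw [h]
    exact hw.fixed_turn h
  have h2 : ∀ f, TouchesFixed σ (σ f) ↔ TouchesFixed σ f := fun f => by
    unfold TouchesFixed
    rw [h1, ← hw.comm, h1]
  have h3 : ∀ f, TouchesFixed σ (ExtModular.cross f) ↔ TouchesFixed σ f := fun f => by
    unfold TouchesFixed
    rw [cross_cross, or_comm]
  rcases h with rfl | rfl | rfl | rfl
  · rfl
  · rw [h3]
  · rw [h2]
  · rw [h2, h3]

lemma isTreeEdge_congr {f f' : ℤ} (h : SameEdge σ f f') :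
    IsTreeEdge σ w f ↔ IsTreeEdge σ w f' := by
  have he := hw.sameEdge_equivalence
  unfold IsTreeEdge
  rw [hw.touchesFixed_congr h]
  refine and_congr_right fun _ => ⟨?_, ?_⟩
  · rintro ⟨r, h1, h2⟩
    exact ⟨r, he.trans (he.symm h) h1, h2⟩
  · rintro ⟨r, h1, h2⟩
    exact ⟨r, he.trans h h1, h2⟩

/-- An edge of a triangle with a rotation of order three is not inverted by the group. -/
lemma invol_ne_cross {f : ℤ} (hf : TouchesFixed σ f) : σ f ≠ cross f := by
  intro h
  rcases hf with hf | hf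
  · exact turn_ne_cross f (hf.symm.trans h)
  · rw [hw.comm, h, cross_cross] at hf
    exact turn_ne_cross (cross f) (by rw [← hf, cross_cross])

lemma exists_edge_rep : ∃ o : ℤ → ℤ, (∀ f, SameEdge σ (o f) f) ∧
    ∀ f f', SameEdge σ f f' → o f = o f' := by
  let s : Setoid ℤ := ⟨SameEdge σ, hw.sameEdge_equivalence⟩
  refine ⟨fun f => (Quotient.mk s f).out, fun f => Quotient.mk_out (s := s) f, fun f f' h => ?_⟩
  have : Quotient.mk s f = Quotient.mk s f' := Quotient.sound h
  simp only [this]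

/-- Increments may be prescribed on representatives of the edges outside the spanning tree. -/
lemma exists_increment {K : Type} [Group K] {o : ℤ → ℤ} (ho : ∀ f, SameEdge σ (o f) f)
    (ho' : ∀ f f', SameEdge σ f f' → o f = o f')
    (α : {j : ℤ // o j = j ∧ ¬ IsTreeEdge σ w j} → K) (hα : ∀ j, α j ^ edgeOrder σ j = 1) :
    ∃ a : ℤ → K, IsIncrement σ w a ∧ ∀ j, a j.1 = α j := by
  classical
  have he := hw.sameEdge_equivalence
  have hoo : ∀ f, o (o f) = o f := fun f => ho' _ _ (ho f)
  let β : ℤ → K := fun f => if h : IsTreeEdge σ w (o f) then 1 else α ⟨o f, hoo f, h⟩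
  have hβ : ∀ f f', SameEdge σ f f' → β f = β f' := fun f f' h => by
    have := ho' f f' h
    simp only [β, this]
  have hβ3 : ∀ f, TouchesFixed σ f → β f ^ 3 = 1 := fun f hf => by
    have h1 := (hw.touchesFixed_congr (ho f)).2 hf
    have h2 : ¬ IsTreeEdge σ w (o f) := fun h => h.1 h1
    have h3 := hα ⟨o f, hoo f, h2⟩
    simpa [β, h2, edgeOrder, h1] using h3
  have hβ2 : ∀ f, ¬ TouchesFixed σ f → σ (o f) = cross (o f) → β f ^ 2 = 1 := fun f hf hf' => by
    have h1 : ¬ TouchesFixed σ (o f) := fun h => hf ((hw.touchesFixed_congr (ho f)).1 h)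
    by_cases h2 : IsTreeEdge σ w (o f)
    · simp [β, h2]
    · have h3 := hα ⟨o f, hoo f, h2⟩
      simpa [β, h2, edgeOrder, h1, hf'] using h3
  -- `P` selects one of the two orientations of each edge; it is ambiguous only for inverted edges,
  -- on which `β` takes values of order at most two
  let P : ℤ → Prop := fun f => f = o f ∨ (f = σ (o f) ∧ ¬ TouchesFixed σ f) ∨
    (f = σ (cross (o f)) ∧ TouchesFixed σ f)
  let a : ℤ → K := fun f => if P f then β f else (β f)⁻¹
  have hc : ∀ f, SameEdge σ f (cross f) := fun f => Or.inr (Or.inl rfl)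
  have hs : ∀ f, SameEdge σ f (σ f) := fun f => Or.inr (Or.inr (Or.inl rfl))
  have hdist : ∀ j, σ j ≠ cross j → j ≠ cross j ∧ j ≠ σ j ∧ j ≠ σ (cross j) ∧ cross j ≠ σ j ∧
      cross j ≠ σ (cross j) ∧ σ j ≠ σ (cross j) ∧ cross (cross j) = j ∧ σ (σ j) = j ∧
      cross (σ j) = σ (cross j) ∧ cross (σ (cross j)) = σ j ∧ σ (σ (cross j)) = cross j := by
    intro j hj
    refine ⟨(cross_ne j).symm, (hw.ne j).symm, fun h => hj ?_, hj.symm, (hw.ne _).symm, ?_, by simp,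
      hw.invol j, (hw.comm j).symm, by rw [← hw.comm, cross_cross], hw.invol _⟩
    · rw [← hw.invol (cross j), ← h]
    · rw [hw.comm]
      exact (cross_ne _).symm
  have hPc : ∀ f, σ (o f) ≠ cross (o f) → (P (cross f) ↔ ¬ P f) := by
    intro f hne
    have e1 : o (cross f) = o f := (ho' _ _ (hc f)).symm
    have e2 := (hw.touchesFixed_congr (hc f))
    have e3 := ho f
    simp only [P, e1, ← e2]
    have hd := hdist (o f) hne
    generalize o f = j at *
    by_cases hE : TouchesFixed σ f <;> simp only [hE] <;> clear hE e2 <;>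
      rcases e3 with rfl | rfl | rfl | rfl <;> grind
  have hPs : ∀ f, σ (o f) ≠ cross (o f) → (P (σ f) ↔ (P f ↔ ¬ TouchesFixed σ f)) := by
    intro f hne
    have e1 : o (σ f) = o f := (ho' _ _ (hs f)).symm
    have e2 := (hw.touchesFixed_congr (hs f))
    have e3 := ho f
    simp only [P, e1, ← e2]
    have hd := hdist (o f) hne
    generalize o f = j at *
    by_cases hE : TouchesFixed σ f <;> simp only [hE] <;> clear hE e2 <;>
      rcases e3 with rfl | rfl | rfl | rfl <;> grind
  have hab : ∀ f, σ (o f) = cross (o f) → ¬ TouchesFixed σ f → a f = β f := by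
    intro f h1 h2
    have h3 := hβ2 f h2 h1
    rw [pow_two, mul_eq_one_iff_eq_inv] at h3
    simp only [a, ← h3, ite_self]
  have htf : ∀ f, σ (o f) = cross (o f) → ¬ TouchesFixed σ f := fun f h1 h2 =>
    hw.invol_ne_cross ((hw.touchesFixed_congr (ho f)).2 h2) h1
  refine ⟨a, ⟨fun f => ?_, fun f hf => ?_, fun f hf => ?_, fun f hf => ?_, fun f hf => ?_⟩, ?_⟩
  · by_cases hne : σ (o f) = cross (o f)
    · have h1 : σ (o (cross f)) = cross (o (cross f)) := by rwa [← ho' _ _ (hc f)]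
      rw [hab f hne (htf f hne), hab _ h1 (htf _ h1), ← hβ _ _ (hc f), ← mul_eq_one_iff_eq_inv,
        ← pow_two]
      exact hβ2 f (htf f hne) hne
    · simp only [a, ← hβ _ _ (hc f), hPc f hne]
      by_cases hP : P f <;> simp [hP]
  · by_cases hne : σ (o f) = cross (o f)
    · have h1 : σ (o (σ f)) = cross (o (σ f)) := by rwa [← ho' _ _ (hs f)]
      rw [hab f hne (htf f hne), hab _ h1 (htf _ h1), ← hβ _ _ (hs f)]
    · simp only [a, ← hβ _ _ (hs f), hPs f hne]
      simp [hf]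
  · have hne : σ (o f) ≠ cross (o f) := fun h => htf f h hf
    simp only [a, ← hβ _ _ (hs f), hPs f hne]
    by_cases hP : P f <;> simp [hP, hf]
  · have h3 := hβ3 f hf
    by_cases hP : P f <;> simp [a, hP, h3]
  · have h1 := (hw.isTreeEdge_congr (ho f)).2 hf
    simp [a, β, h1]
  · rintro ⟨j, h1, h2⟩
    have h3 : P j := Or.inl h1.symm
    simp only [a, h3, if_true, β, h1, h2, dif_neg, not_false_eq_true]

end IsFlagSystem

end

/-! ### The group of a flag system is a free product of cyclic groups -/

section

variable {H : Type} [Group H] {σ : ℤ → ℤ} {w : ℤ → H}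

lemma eq_or_eq_inv_of_sameEdge {K : Type} [Group K] {a : ℤ → K}
    (h1 : ∀ f, a (cross f) = (a f)⁻¹) (h2 : ∀ f, a (σ f) = a f ∨ a (σ f) = (a f)⁻¹) {f f' : ℤ}
    (h : SameEdge σ f f') : a f' = a f ∨ a f' = (a f)⁻¹ := by
  rcases h with rfl | rfl | rfl | rfl
  · exact Or.inl rfl
  · exact Or.inr (h1 f)
  · exact h2 f
  · rcases h2 (cross f) with h3 | h3 <;> rw [h3, h1] <;> simp

namespace IsFlagSystem

variable (hw : IsFlagSystem σ w)
include hw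

lemma cube_of_fixed {f : ℤ} (hf : σ f = turn f) : w f ^ 3 = 1 := by
  have h1 := hw.w_turn f
  have h2 := hw.w_invol f
  rw [hf, turn_turn] at h1
  rw [hf, h1] at h2
  rw [pow_succ, pow_two, h2, inv_mul_cancel]

/-- The potential `c` and the increments `a` define a homomorphism on `H`, by its presentation.
Here `c f` plays the role of the image of the gauge, and the second formula accounts for the
rotations of order three. -/
lemma exists_hom_of_increment {K : Type} [Group K] {a c : ℤ → K} (ha : IsIncrement σ w a)
    (hc : ∀ f, c (turn f) = c f) (hc' : ∀ f, c (cross f) = c f * a f) :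
    ∃ φ : H →* K, (∀ f, σ f ≠ turn f → φ (w f) = c f * (c (σ f))⁻¹) ∧
      ∀ f, σ f = turn f → φ (w f) = c f * (a f)⁻¹ * (c f)⁻¹ := by
  classical
  let u : ℤ → K := fun f => if σ f = turn f then (a f)⁻¹ else 1
  let k : ℤ → K := fun f => c f * u f * (c (σ f))⁻¹
  have hfix : ∀ f, σ f = turn f → TouchesFixed σ f := fun f hf => Or.inl hf
  have hcs : ∀ f, σ f = turn f → c (σ f) = c f := fun f hf => by rw [hf, hc]
  have hk1 : ∀ f, σ f ≠ turn f → k f = c f * (c (σ f))⁻¹ := fun f hf => by simp [k, u, hf]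
  have hk3 : ∀ f, σ f = turn f → k f = c f * (a f)⁻¹ * (c f)⁻¹ := fun f hf => by
    simp only [k, u, hf, if_true, hc]
  have k_invol : ∀ f, k (σ f) = (k f)⁻¹ := by
    intro f
    by_cases hf : σ f = turn f
    · have hf' : σ (σ f) = turn (σ f) := by rw [hf]; exact hw.fixed_turn hf
      rw [hk3 f hf, hk3 _ hf', hcs f hf, ha.invol_fixed f (hfix f hf)]
      group
    · rw [hk1 f hf, hk1 _ (hw.not_fixed_invol hf), hw.invol]
      group
  have k_cross : ∀ f, k (cross f) = k f := by
    have key : ∀ f, σ f = turn f → k (cross f) = k f := by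
      intro f hf
      rw [hk3 f hf, hk1 _ (hw.not_fixed_cross hf), hw.comm, hc', hc',
        ha.invol_fixed f (hfix f hf), hcs f hf]
      have h3 : a f * a f = (a f)⁻¹ := by
        rw [← mul_eq_one_iff_eq_inv, ← pow_two, ← pow_succ]
        exact ha.cube f (hfix f hf)
      have h4 : c f * a f * (c f * (a f)⁻¹)⁻¹ = c f * (a f * a f) * (c f)⁻¹ := by group
      rw [h4, h3]
    intro f
    by_cases hf : σ f = turn f
    · exact key f hf
    by_cases hf' : σ (cross f) = turn (cross f)
    · have := key _ hf'
      rw [cross_cross] at this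
      exact this.symm
    · have hn : ¬ TouchesFixed σ f := fun h => h.elim hf hf'
      rw [hk1 f hf, hk1 _ hf', hw.comm, hc', hc', ha.invol f hn]
      group
  have k_turn : ∀ f, k (turn f) = k f * k (turn (σ f)) := by
    intro f
    by_cases hf : σ f = turn f
    · have h1 : k (turn f) = (k f)⁻¹ := by rw [← hf, k_invol]
      have h2 : k f ^ 3 = 1 := by
        rw [hk3 f hf, conj_pow, inv_pow, ha.cube f (hfix f hf)]
        simp
      have h3 : k f * k f = (k f)⁻¹ := by
        rw [← mul_eq_one_iff_eq_inv, ← pow_two, ← pow_succ]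
        exact h2
      rw [h1, hf, turn_turn, h3]
    · have h1 : σ (turn f) ≠ turn (turn f) := fun h => hf (by
        have := hw.fixed_turn h
        simpa using this)
      have h2 : σ (turn (σ f)) ≠ turn (turn (σ f)) := fun h => hw.not_fixed_invol hf (by
        have := hw.fixed_turn h
        simpa using this)
      rw [hk1 f hf, hk1 _ h1, hk1 _ h2, hw.braid, hc, hc, hc]
      group
  obtain ⟨φ, hφ⟩ := hw.exists_lift K k k_cross k_invol k_turn
  exact ⟨φ, fun f hf => (hφ f).trans (hk1 f hf), fun f hf => (hφ f).trans (hk3 f hf)⟩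

/-- The group of a flag system is a free product of cyclic groups of orders `2`, `3` and `∞`: the
elements `(g f)⁻¹ * g (cross f)`, for a gauge `g`, pair the sides of the fundamental domain, and one
of them for each class of edges outside the spanning tree is a free generator. -/
theorem exists_isFreeFamily : ∃ (J : Type) (x : J → H) (n : J → ℕ),
    IsFreeFamily x n ∧ ∀ j, n j = 2 ∨ n j = 3 ∨ n j = 0 := by
  classical
  obtain ⟨g, G0, G1, G2, G3, G4⟩ := hw.exists_gauge
  obtain ⟨o, ho, ho'⟩ := hw.exists_edge_rep
  let b : ℤ → H := fun f => (g f)⁻¹ * g (cross f)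
  have b_cross : ∀ f, b (cross f) = (b f)⁻¹ := fun f => by simp [b]
  have b_invol : ∀ f, ¬ TouchesFixed σ f → b (σ f) = b f := by
    intro f hf
    have h1 := G2 f fun h => hf (Or.inl h)
    have h2 := G2 (cross f) fun h => hf (Or.inr h)
    rw [hw.w_cross, hw.comm] at h2
    simp only [b, ← h1, ← h2]
    group
  have b_fixed : ∀ f, σ f = turn f → b f = (g f)⁻¹ * (w f)⁻¹ * g f := by
    intro f hf
    rw [G3 f hf]
    simp only [b]
    group
  have b_invol_fixed : ∀ f, TouchesFixed σ f → b (σ f) = (b f)⁻¹ := by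
    have key : ∀ f, σ f = turn f → b (σ f) = (b f)⁻¹ := by
      intro f hf
      have hf' : σ (σ f) = turn (σ f) := by rw [hf]; exact hw.fixed_turn hf
      have h1 : g (σ f) = g f := by rw [hf, G1]
      rw [b_fixed f hf, b_fixed _ hf', hw.w_invol, h1]
      group
    rintro f (hf | hf)
    · exact key f hf
    · have h1 := key _ hf
      rw [hw.comm, b_cross, b_cross] at h1
      rw [← inv_inj, h1]
  have b_cube : ∀ f, TouchesFixed σ f → b f ^ 3 = 1 := by
    have key : ∀ f, σ f = turn f → b f ^ 3 = 1 := by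
      intro f hf
      have h1 : b f = (g f)⁻¹ * (w f)⁻¹ * (g f)⁻¹⁻¹ := by rw [b_fixed f hf, inv_inv]
      rw [h1, conj_pow, inv_pow, hw.cube_of_fixed hf]
      simp
    rintro f (hf | hf)
    · exact key f hf
    · have h1 := key _ hf
      rwa [b_cross, inv_pow, inv_eq_one] at h1
  have b_invol' : ∀ f, b (σ f) = b f ∨ b (σ f) = (b f)⁻¹ := fun f => by
    by_cases hf : TouchesFixed σ f
    · exact Or.inr (b_invol_fixed f hf)
    · exact Or.inl (b_invol f hf)
  have b_tree : ∀ f, IsTreeEdge σ w f → b f = 1 := by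
    rintro f ⟨hf, f', h1, h2, h3⟩
    have h4 : ¬ TouchesFixed σ f' := fun h => hf ((hw.touchesFixed_congr h1).2 h)
    have h5 : b f' = 1 := by
      have := G4 f' h2 h3 (fun h => h4 (Or.inl h)) (fun h => h4 (Or.inr h))
      simp [b, ← this]
    rcases eq_or_eq_inv_of_sameEdge b_cross b_invol' h1 with h6 | h6 <;> simpa [h5] using h6.symm
  refine ⟨{j : ℤ // o j = j ∧ ¬ IsTreeEdge σ w j}, fun j => b j, fun j => edgeOrder σ j,
    ⟨?_, ?_, ?_⟩, fun j => edgeOrder_mem σ j⟩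
  · rintro ⟨j, -⟩
    by_cases h1 : TouchesFixed σ j
    · simpa [edgeOrder, h1] using b_cube j h1
    · by_cases h2 : σ j = cross j
      · have h3 := b_invol j h1
        rw [h2, b_cross, eq_comm, ← mul_eq_one_iff_eq_inv, ← pow_two] at h3
        simpa [edgeOrder, h1, h2] using h3
      · simp [edgeOrder, h1, h2]
  · set P := Subgroup.closure (Set.range fun j : {j : ℤ // o j = j ∧ ¬ IsTreeEdge σ w j} => b j)
      with hP
    have hb : ∀ f, b f ∈ P := by
      intro f
      have h1 : b (o f) ∈ P := by
        by_cases hT : IsTreeEdge σ w (o f)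
        · rw [b_tree _ hT]
          exact one_mem P
        · exact Subgroup.subset_closure ⟨⟨o f, ho' _ _ (ho f), hT⟩, rfl⟩
      rcases eq_or_eq_inv_of_sameEdge b_cross b_invol' (ho f) with h6 | h6 <;> rw [h6]
      · exact h1
      · exact inv_mem h1
    have hcr : ∀ f, g (cross f) = g f * b f := fun f => by simp [b]
    have hg' : ∀ m : ℕ, ∀ f, rank f ≤ m → g f ∈ P := by
      intro m
      induction m with
      | zero =>
        intro f hf
        have : f = 0 := rank_injective (by simpa [rank] using hf)
        rw [this, G0]
        exact one_mem P
      | succ m ih =>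
        intro f hf
        by_cases h0 : f = 0
        · rw [h0, G0]
          exact one_mem P
        by_cases hr : rank f ≤ rank (turn f)
        · have h1 := rank_cross_lt h0 hr
          have h2 := mul_mem (ih (cross f) (by omega)) (hb (cross f))
          rwa [← hcr, cross_cross] at h2
        · have h1 := ih (turn f) (by omega)
          rwa [G1] at h1
    have hg : ∀ f, g f ∈ P := fun f => hg' _ f le_rfl
    rw [eq_top_iff, ← hw.closure_range, Subgroup.closure_le]
    rintro _ ⟨f, rfl⟩
    by_cases hf : σ f = turn f
    · rw [G3 f hf]
      exact mul_mem (hg _) (inv_mem (hg _))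
    · rw [← mul_inv_eq_iff_eq_mul.2 (G2 f hf).symm]
      exact mul_mem (hg _) (inv_mem (hg _))
  · intro K _ α hα
    obtain ⟨a, ha, haα⟩ := hw.exists_increment ho ho' α hα
    obtain ⟨c, c0, c1, c2⟩ := exists_path_potential a ha.cross
    obtain ⟨φ, hφ1, hφ3⟩ := hw.exists_hom_of_increment ha c1 c2
    refine ⟨φ, ?_⟩
    -- the discrepancy between `c` and the image of the gauge `g`
    let D : ℤ → K := fun f => (c f)⁻¹ * φ (g f)
    have D_turn : ∀ f, D (turn f) = D f := fun f => by simp [D, c1, G1]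
    have D_invol : ∀ f, D (σ f) = D f := by
      intro f
      by_cases hf : σ f = turn f
      · rw [hf, D_turn]
      · have h1 := congrArg φ (G2 f hf)
        rw [map_mul, hφ1 f hf] at h1
        simp only [D, ← h1]
        group
    have D_fixed : ∀ f, σ f = turn f → D (cross f) = D f := by
      intro f hf
      have h1 := G3 f hf
      rw [eq_mul_inv_iff_mul_eq] at h1
      have h2 := congrArg φ h1
      rw [map_mul, hφ3 f hf] at h2
      simp only [D, ← h2, c2]
      group
    have D_transport : ∀ f v f', Transport σ w f v f' → D f' = D f := by
      intro f v f' h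
      induction h with
      | refl => rfl
      | step_turn _ ih => rw [D_turn, ih]
      | step_invol _ ih => rw [D_invol, ih]
    have D_const : ∀ m : ℕ, ∀ f, rank f ≤ m → D f = 1 := by
      have D0 : D 0 = 1 := by simp [D, c0, G0]
      intro m
      induction m with
      | zero =>
        intro f hf
        have : f = 0 := rank_injective (by simpa [rank] using hf)
        rw [this, D0]
      | succ m ih =>
        intro f hf
        by_cases hrep : IsRep σ w f
        · by_cases h0 : f = 0
          · rw [h0, D0]
          have h1 := ih (cross f) (by
            have := rank_cross_lt h0 (hrep 1 _ Transport.refl.step_turn)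
            omega)
          by_cases hf1 : σ f = turn f
          · rw [← D_fixed f hf1, h1]
          by_cases hf2 : σ (cross f) = turn (cross f)
          · have h2 := D_fixed _ hf2
            rwa [cross_cross, h1] at h2
          have hT : IsTreeEdge σ w f :=
            ⟨fun h => h.elim hf1 hf2, f, Or.inl rfl, hrep, h0⟩
          have h2 := G4 f hrep h0 hf1 hf2
          rw [← h1]
          simp only [D, c2, ha.tree f hT, h2, mul_one]
        · unfold IsRep at hrep
          push Not at hrep
          obtain ⟨v, f', h1, h2⟩ := hrep
          rw [← D_transport f v f' h1]
          exact ih f' (by omega)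
    have hφg : ∀ f, φ (g f) = c f := fun f => by
      have h1 := D_const _ f le_rfl
      simp only [D] at h1
      rwa [inv_mul_eq_one, eq_comm] at h1
    rintro j
    rw [← haα j]
    simp only [b, map_mul, map_inv, hφg, c2]
    group

end IsFlagSystem

end

/-! ### Cusps and the Farey complex -/

/-- The numerator of a cusp in lowest terms; `∞` is `1 / 0`. -/
def cuspNum : OnePoint ℚ → ℤ := fun r => r.elim 1 Rat.num

/-- The denominator of a cusp in lowest terms; `∞` is `1 / 0`. -/
def cuspDen : OnePoint ℚ → ℤ := fun r => r.elim 0 fun q => q.den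

/-- The cusp `p / q`, with `p / 0 = ∞`. -/
def cusp (p q : ℤ) : OnePoint ℚ := if q = 0 then OnePoint.infty else ((p / q : ℚ) : OnePoint ℚ)

@[simp] lemma cuspNum_infty : cuspNum OnePoint.infty = 1 := rfl
@[simp] lemma cuspDen_infty : cuspDen OnePoint.infty = 0 := rfl
@[simp] lemma cuspNum_coe (q : ℚ) : cuspNum (q : OnePoint ℚ) = q.num := rfl
@[simp] lemma cuspDen_coe (q : ℚ) : cuspDen (q : OnePoint ℚ) = q.den := rfl

lemma cuspDen_nonneg (r : OnePoint ℚ) : 0 ≤ cuspDen r := by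
  induction r using OnePoint.rec <;> simp

lemma cuspDen_eq_zero {r : OnePoint ℚ} : cuspDen r = 0 ↔ r = OnePoint.infty := by
  induction r using OnePoint.rec <;> simp

lemma isCoprime_cusp (r : OnePoint ℚ) : IsCoprime (cuspNum r) (cuspDen r) := by
  induction r using OnePoint.rec with
  | infty => exact isCoprime_one_left
  | coe q => simpa using Rat.isCoprime_num_den q

lemma cusp_ext {r s : OnePoint ℚ} (h : cuspNum r = cuspNum s) (h' : cuspDen r = cuspDen s) :
    r = s := by
  induction r using OnePoint.rec with
  | infty => exact (cuspDen_eq_zero.1 h'.symm).symm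
  | coe q =>
    induction s using OnePoint.rec with
    | infty => exact cuspDen_eq_zero.1 h'
    | coe q' =>
      congr 1
      exact Rat.ext h (by simpa using h')

lemma cusp_num_den {p q : ℤ} (h : IsCoprime p q) : ∃ e : ℤ, (e = 1 ∨ e = -1) ∧
    cuspNum (cusp p q) = e * p ∧ cuspDen (cusp p q) = e * q := by
  rcases lt_trichotomy q 0 with hq | hq | hq
  · refine ⟨-1, Or.inr rfl, ?_⟩
    have h1 : ((p : ℚ) / q) = ((-p : ℤ) : ℚ) / ((-q : ℤ) : ℚ) := by push_cast; rw [neg_div_neg_eq]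
    have h2 : Nat.Coprime (-p).natAbs (-q).natAbs := by
      rw [Int.natAbs_neg, Int.natAbs_neg]; exact Int.isCoprime_iff_gcd_eq_one.1 h
    simp only [cusp, hq.ne, if_false, cuspNum_coe, cuspDen_coe, h1]
    rw [Rat.num_div_eq_of_coprime (by omega) h2, Rat.den_div_eq_of_coprime (by omega) h2]
    simp
  · subst hq
    rw [isCoprime_zero_right, Int.isUnit_iff] at h
    refine ⟨p, h, ?_⟩
    simp only [cusp, if_true, cuspNum_infty, cuspDen_infty, mul_zero, and_true]
    rcases h with rfl | rfl <;> simp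
  · refine ⟨1, Or.inl rfl, ?_⟩
    have h2 : Nat.Coprime p.natAbs q.natAbs := Int.isCoprime_iff_gcd_eq_one.1 h
    simp only [cusp, hq.ne', if_false, cuspNum_coe, cuspDen_coe]
    rw [Rat.num_div_eq_of_coprime hq h2, Rat.den_div_eq_of_coprime hq h2]
    simp

lemma moebius_mk (A : GL (Fin 2) ℤ) (r : OnePoint ℚ) :
    moebius (Matrix.ProjGenLinGroup.mk A) r =
      cusp (A 0 0 * cuspNum r + A 0 1 * cuspDen r) (A 1 0 * cuspNum r + A 1 1 * cuspDen r) := by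
  change (Matrix.GeneralLinearGroup.map (Int.castRingHom ℚ) A) • r = _
  induction r using OnePoint.rec with
  | infty => simp [OnePoint.smul_infty_eq_ite, cusp]
  | coe q =>
    have hd : (q.den : ℚ) ≠ 0 := by exact_mod_cast q.den_ne_zero
    have key : ∀ a b : ℤ, (a * q.num + b * q.den : ℚ) = (a * q + b) * q.den := by
      intro a b
      rw [add_mul, mul_assoc, Rat.mul_den_eq_num]
    have h1 : ((A 1 0 * q.num + A 1 1 * q.den : ℤ) = 0) ↔ (A 1 0 : ℚ) * q + A 1 1 = 0 := by
      rw [← Int.cast_inj (α := ℚ)]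
      push_cast
      rw [key, mul_eq_zero, or_iff_left hd]
    rw [OnePoint.smul_some_eq_ite]
    simp only [cusp, cuspNum_coe, cuspDen_coe, h1, Matrix.GeneralLinearGroup.map_apply,
      eq_intCast]
    push_cast
    simp only [key, mul_div_mul_right _ _ hd]

/-- The determinant of the vectors of two cusps. -/
def cuspDet (r s : OnePoint ℚ) : ℤ := cuspNum r * cuspDen s - cuspNum s * cuspDen r

/-- Adjacency in the Farey graph. The sign of the determinant depends on the choice of the primitive
vectors and on the order of the cusps. -/
def FareyAdj (r s : OnePoint ℚ) : Prop := cuspDet r s = 1 ∨ cuspDet r s = -1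

lemma moebius_mk_num_den (A : GL (Fin 2) ℤ) (r : OnePoint ℚ) : ∃ e : ℤ, (e = 1 ∨ e = -1) ∧
    cuspNum (moebius (Matrix.ProjGenLinGroup.mk A) r) =
      e * (A 0 0 * cuspNum r + A 0 1 * cuspDen r) ∧
    cuspDen (moebius (Matrix.ProjGenLinGroup.mk A) r) =
      e * (A 1 0 * cuspNum r + A 1 1 * cuspDen r) := by
  rw [moebius_mk]
  apply cusp_num_den
  obtain ⟨u, v, huv⟩ := isCoprime_cusp r
  have hdet : (A.det : ℤ) = A 0 0 * A 1 1 - A 0 1 * A 1 0 := by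
    rw [Matrix.GeneralLinearGroup.val_det_apply, Matrix.det_fin_two]
  have hdd : (A.det : ℤ) * A.det = 1 := by
    rcases Int.units_eq_one_or A.det with h | h <;> simp [h]
  set D : ℤ := ((A.det : ℤˣ) : ℤ)
  refine ⟨D * (u * A 1 1 - v * A 1 0), D * (v * A 0 0 - u * A 0 1), ?_⟩
  have : D * (u * A 1 1 - v * A 1 0) * (A 0 0 * cuspNum r + A 0 1 * cuspDen r) +
      D * (v * A 0 0 - u * A 0 1) * (A 1 0 * cuspNum r + A 1 1 * cuspDen r) =
      D * (A 0 0 * A 1 1 - A 0 1 * A 1 0) * (u * cuspNum r + v * cuspDen r) := by ring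
  rw [this, huv, ← hdet, hdd, one_mul]

lemma FareyAdj.moebius {r s : OnePoint ℚ} (h : FareyAdj r s) (γ : PGL(2, ℤ)) :
    FareyAdj (moebius γ r) (moebius γ s) := by
  obtain ⟨A, rfl⟩ := Matrix.ProjGenLinGroup.mk_surjective γ
  obtain ⟨e, he, h1, h2⟩ := moebius_mk_num_den A r
  obtain ⟨e', he', h3, h4⟩ := moebius_mk_num_den A s
  have hdet : (A.det : ℤ) = A 0 0 * A 1 1 - A 0 1 * A 1 0 := by
    rw [Matrix.GeneralLinearGroup.val_det_apply, Matrix.det_fin_two]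
  have h5 : cuspDet (ExtModular.moebius (Matrix.ProjGenLinGroup.mk A) r)
      (ExtModular.moebius (Matrix.ProjGenLinGroup.mk A) s) = e * e' * A.det * cuspDet r s := by
    rw [cuspDet, h1, h2, h3, h4, hdet, cuspDet]
    ring
  unfold FareyAdj at *
  rw [h5]
  rcases he with rfl | rfl <;> rcases he' with rfl | rfl <;>
    rcases Int.units_eq_one_or A.det with hA | hA <;> rw [hA] <;> rcases h with h | h <;>
    rw [h] <;> simp

lemma FareyAdj.symm {r s : OnePoint ℚ} (h : FareyAdj r s) : FareyAdj s r := by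
  unfold FareyAdj cuspDet at *
  omega

lemma fareyAdj_infty_int (n : ℤ) : FareyAdj OnePoint.infty ((n : ℚ) : OnePoint ℚ) := by
  simp [FareyAdj, cuspDet]

lemma FareyAdj.exists_int {s : OnePoint ℚ} (h : FareyAdj OnePoint.infty s) :
    ∃ n : ℤ, s = ((n : ℚ) : OnePoint ℚ) := by
  have h0 := cuspDen_nonneg s
  have h1 : cuspDen s = 1 := by
    simp only [FareyAdj, cuspDet, cuspNum_infty, cuspDen_infty, one_mul, mul_zero, sub_zero] at h
    omega
  exact ⟨cuspNum s, cusp_ext (by simp) (by simp [h1])⟩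

/-- Two neighbours of a cusp of smaller denominator are equal or adjacent. -/
lemma FareyAdj.eq_or_adj {r s t : OnePoint ℚ} (hr : FareyAdj r t) (hs : FareyAdj s t)
    (hrt : cuspDen r < cuspDen t) (hst : cuspDen s < cuspDen t) : r = s ∨ FareyAdj r s := by
  have h1 := cuspDen_nonneg r
  have h2 := cuspDen_nonneg s
  obtain ⟨u, v, huv⟩ := isCoprime_cusp t
  have n1 : r = OnePoint.infty ∨ cuspDen r ≠ 0 := by
    by_cases h : r = OnePoint.infty <;> simp [h, cuspDen_eq_zero]
  unfold FareyAdj cuspDet at hr hs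
  set q := cuspDen t
  set p := cuspNum t
  set q₁ := cuspDen r with hq₁
  set p₁ := cuspNum r with hp₁
  set q₂ := cuspDen s with hq₂
  set p₂ := cuspNum s with hp₂
  have hq : q ≠ 0 := by omega
  by_cases heq : p₁ * q - p * q₁ = p₂ * q - p * q₂
  · left
    have h3 : q * (p₁ - p₂) = p * (q₁ - q₂) := by linarith
    have h4 : q ∣ q₁ - q₂ :=
      (isCoprime_cusp t).symm.dvd_of_dvd_mul_left (Dvd.intro _ h3)
    have h5 : q₁ - q₂ = 0 := Int.eq_zero_of_abs_lt_dvd h4 (by rw [abs_lt]; constructor <;> linarith)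
    rw [h5, mul_zero, mul_eq_zero, or_iff_right hq] at h3
    exact cusp_ext (by linarith) (by linarith)
  · have h3 : q * (p₁ + p₂) = p * (q₁ + q₂) := by
      have : (p₁ * q - p * q₁) + (p₂ * q - p * q₂) = 0 := by omega
      linarith
    have h4 : q ∣ q₁ + q₂ :=
      (isCoprime_cusp t).symm.dvd_of_dvd_mul_left (Dvd.intro _ h3)
    obtain ⟨k, hk⟩ := h4
    have hk0 : 0 ≤ k := by
      by_contra h
      nlinarith
    have hk2 : k < 2 := by
      by_contra h
      nlinarith
    obtain rfl | rfl : k = 0 ∨ k = 1 := by omega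
    · left
      have e1 : q₁ = 0 := by linarith
      have e2 : q₂ = 0 := by linarith
      rw [cuspDen_eq_zero.1 e1, cuspDen_eq_zero.1 e2]
    · right
      have e1 : q₂ = q - q₁ := by linarith
      have e2 : p₂ = p - p₁ := by
        have : q * (p₁ + p₂) = q * p := by rw [h3, hk]; ring
        have := mul_left_cancel₀ hq this
        linarith
      have e3 : cuspDet r s = p₁ * q - p * q₁ := by
        rw [cuspDet, ← hp₁, ← hp₂, ← hq₁, ← hq₂, e1, e2]
        ring
      rw [FareyAdj, e3]
      exact hr

/-- Every cusp other than `∞` has a neighbour of smaller denominator. -/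
lemma exists_fareyAdj_lt {r : OnePoint ℚ} (hr : r ≠ OnePoint.infty) :
    ∃ s, FareyAdj s r ∧ cuspDen s < cuspDen r := by
  have h0 : 0 < cuspDen r :=
    lt_of_le_of_ne (cuspDen_nonneg r) fun h => hr (cuspDen_eq_zero.1 h.symm)
  obtain ⟨u, v, huv⟩ := isCoprime_cusp r
  set p := cuspNum r with hp
  set q := cuspDen r with hq
  -- the Bezout coefficient is reduced modulo `q`
  have h1 : (v - (-u) / q * p) * q - p * (-u % q) = 1 := by
    have := Int.emod_def (-u) q
    rw [this]
    linear_combination huv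
  set y := -u % q
  set x := v - (-u) / q * p
  have hy0 : 0 ≤ y := Int.emod_nonneg _ h0.ne'
  have hyq : y < q := Int.emod_lt_of_pos _ h0
  obtain ⟨e, he, h2, h3⟩ := cusp_num_den (p := x) (q := y) ⟨q, -p, by linarith⟩
  refine ⟨cusp x y, ?_, ?_⟩
  · rw [FareyAdj, cuspDet, h2, h3, ← hp, ← hq]
    have : e * x * q - p * (e * y) = e := by linear_combination e * h1
    rwa [this]
  · rw [h3]
    rcases he with rfl | rfl <;> linarith

/-- Induction along the edges of the Farey graph, starting at `∞`. -/
lemma farey_induction {P : OnePoint ℚ → Prop} (h0 : P OnePoint.infty)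
    (h1 : ∀ r s, FareyAdj r s → P r → P s) (r : OnePoint ℚ) : P r := by
  have key : ∀ m : ℕ, ∀ r, (cuspDen r).toNat ≤ m → P r := by
    intro m
    induction m with
    | zero =>
      intro r hr
      have := cuspDen_nonneg r
      rw [cuspDen_eq_zero.1 (by omega : cuspDen r = 0)]
      exact h0
    | succ m ih =>
      intro r hr
      by_cases hr0 : r = OnePoint.infty
      · rwa [hr0]
      · obtain ⟨s, hs, hlt⟩ := exists_fareyAdj_lt hr0
        have := cuspDen_nonneg s
        exact h1 s r hs (ih s (by omega))
  exact key _ r le_rfl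

/-- The Farey complex is simply connected: a function on its directed edges which is multiplicative
on triangles is the coboundary of a function on the cusps. The function is constructed by descent to
neighbours of smaller denominator; the choice of the neighbour does not matter, since any two of
them are adjacent to each other. -/
theorem exists_farey_potential {K : Type} [Group K] (F : OnePoint ℚ → OnePoint ℚ → K)
    (h2 : ∀ r s, FareyAdj r s → F r s * F s r = 1)
    (h3 : ∀ r s t, FareyAdj r s → FareyAdj s t → FareyAdj r t → F r s * F s t = F r t) :
    ∃ κ : OnePoint ℚ → K, κ OnePoint.infty = 1 ∧ ∀ r s, FareyAdj r s → κ s = κ r * F r s := by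
  classical
  have hex : ∀ r : OnePoint ℚ, ∃ s, r ≠ OnePoint.infty → FareyAdj s r ∧ cuspDen s < cuspDen r := by
    intro r
    by_cases hr : r = OnePoint.infty
    · exact ⟨r, fun h => absurd hr h⟩
    · obtain ⟨s, hs⟩ := exists_fareyAdj_lt hr
      exact ⟨s, fun _ => hs⟩
  choose p hp using hex
  let κ : OnePoint ℚ → K := fun r =>
    (descent (fun r => (cuspDen r).toNat) p (fun r => (F (p r) r)⁻¹) r)⁻¹
  have κ0 : κ OnePoint.infty = 1 := by
    simp only [κ]
    rw [descent, dif_neg (by simp), inv_one]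
  have κp : ∀ r, r ≠ OnePoint.infty → κ r = κ (p r) * F (p r) r := by
    intro r hr
    have h4 := (hp r hr).2
    have h5 := cuspDen_nonneg (p r)
    simp only [κ]
    rw [descent, dif_pos (by omega)]
    simp
  have hsymm : ∀ r s, FareyAdj r s → κ s = κ r * F r s → κ r = κ s * F s r := by
    intro r s hrs h
    rw [h, mul_assoc, h2 r s hrs, mul_one]
  have key : ∀ m : ℕ, ∀ r s, FareyAdj r s → cuspDen r ≤ m → cuspDen s ≤ m →
      κ s = κ r * F r s := by
    intro m
    induction m with
    | zero =>
      intro r s hrs hr hs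
      have := cuspDen_nonneg r
      have := cuspDen_nonneg s
      simp only [FareyAdj, cuspDet] at hrs
      rw [(by push_cast at *; omega : cuspDen r = 0), (by push_cast at *; omega : cuspDen s = 0)]
        at hrs
      simp at hrs
    | succ m ih =>
      have hlt : ∀ r s, FareyAdj r s → cuspDen r < cuspDen s → cuspDen s ≤ m + 1 →
          κ s = κ r * F r s := by
        intro r s hrs hr hs
        have hs0 : s ≠ OnePoint.infty := by
          rintro rfl
          have := cuspDen_nonneg r
          simp at hr
          omega
        obtain ⟨h4, h5⟩ := hp s hs0
        rcases hrs.eq_or_adj h4 hr h5 with h6 | h6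
        · rw [h6]
          exact κp s hs0
        · rw [κp s hs0, ih r (p s) h6 (by omega) (by omega), mul_assoc, h3 r (p s) s h6 h4 hrs]
      intro r s hrs hr hs
      push_cast at hr hs
      rcases lt_trichotomy (cuspDen r) (cuspDen s) with h | h | h
      · exact hlt r s hrs h hs
      · -- adjacent cusps of equal denominator are consecutive integers
        have hr1 : cuspDen r = 1 := by
          have h5 : cuspDen r ∣ 1 := by
            simp only [FareyAdj, cuspDet] at hrs
            rw [← h, ← sub_mul] at hrs
            rcases hrs with h6 | h6
            · exact Dvd.intro_left _ h6
            · exact (dvd_neg.1 (Dvd.intro_left _ h6))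
          exact Int.eq_one_of_dvd_one (cuspDen_nonneg r) h5
        have hs1 : cuspDen s = 1 := h ▸ hr1
        have a1 : FareyAdj OnePoint.infty r := by simp [FareyAdj, cuspDet, hr1]
        have a2 : FareyAdj OnePoint.infty s := by simp [FareyAdj, cuspDet, hs1]
        rw [hlt _ r a1 (by simp [hr1]) hr, hlt _ s a2 (by simp [hs1]) hs, mul_assoc,
          h3 _ r s a1 hrs a2]
      · exact hsymm s r hrs.symm (hlt s r hrs.symm h hr)
  refine ⟨κ, κ0, fun r s hrs => ?_⟩
  have h4 := cuspDen_nonneg r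
  have h5 := cuspDen_nonneg s
  exact key (cuspDen r + cuspDen s).toNat r s hrs (by omega) (by omega)

/-! ### The flag system of a Neumann subgroup -/

section

variable {Shat : Subgroup PGL(2, ℤ)}

/-- The other end of the edge of the flag `f` at `∞`: both flags `2 * n - 1` and `2 * n` lie at
the edge joining `∞` to `n`. -/
def flagCusp (f : ℤ) : OnePoint ℚ := (((f + 1) / 2 : ℤ) : ℚ)

lemma flagCusp_two_mul (n : ℤ) : flagCusp (2 * n) = ((n : ℚ) : OnePoint ℚ) := by
  have : (2 * n + 1) / 2 = n := by omega
  rw [flagCusp, this]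

@[simp] lemma flagCusp_ne_infty (f : ℤ) : flagCusp f ≠ OnePoint.infty := OnePoint.coe_ne_infty _

@[simp] lemma cuspNum_flagCusp (f : ℤ) : cuspNum (flagCusp f) = (f + 1) / 2 := by simp [flagCusp]

@[simp] lemma cuspDen_flagCusp (f : ℤ) : cuspDen (flagCusp f) = 1 := by simp [flagCusp]

@[simp] lemma flagCusp_cross (f : ℤ) : flagCusp (cross f) = flagCusp f := by
  apply cusp_ext <;> simp
  simp only [cross]
  split_ifs <;> omega

/-- A flag is determined by its edge and the third vertex of its triangle. -/
lemma flag_ext {f f' : ℤ} (h : flagCusp f = flagCusp f')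
    (h' : flagCusp (turn f) = flagCusp (turn f')) : f = f' := by
  have h1 := congrArg cuspNum h
  have h2 := congrArg cuspNum h'
  simp only [cuspNum_flagCusp, turn] at h1 h2
  split_ifs at h2 <;> omega

lemma eq_or_eq_cross {f f' : ℤ} (h : flagCusp f' = flagCusp f) : f' = f ∨ f' = cross f := by
  have h1 := congrArg cuspNum h
  simp only [cuspNum_flagCusp, cross] at h1 ⊢
  split_ifs <;> omega

lemma fareyAdj_flagCusp (f : ℤ) : FareyAdj OnePoint.infty (flagCusp f) := fareyAdj_infty_int _

lemma fareyAdj_turn (f : ℤ) : FareyAdj (flagCusp f) (flagCusp (turn f)) := by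
  simp only [FareyAdj, cuspDet, cuspNum_flagCusp, cuspDen_flagCusp, turn]
  split_ifs <;> omega

lemma exists_flag {r s : OnePoint ℚ} (hr : FareyAdj OnePoint.infty r)
    (hs : FareyAdj OnePoint.infty s) (hrs : FareyAdj r s) :
    ∃ f, flagCusp f = r ∧ flagCusp (turn f) = s := by
  obtain ⟨n, rfl⟩ := hr.exists_int
  obtain ⟨m, rfl⟩ := hs.exists_int
  simp only [FareyAdj, cuspDet, cuspNum_coe, cuspDen_coe, Rat.num_intCast, Rat.den_intCast] at hrs
  push_cast at hrs
  rcases hrs with h | h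
  · refine ⟨2 * n - 1, cusp_ext ?_ (by simp), cusp_ext ?_ (by simp)⟩
    · simp
    · simp [turn]; omega
  · refine ⟨2 * n, cusp_ext ?_ (by simp), cusp_ext ?_ (by simp)⟩
    · simp; omega
    · simp [turn]; omega

/-- The action of a subgroup of `PGL(2, ℤ)` on the cusps. -/
def act (γ : Shat) (r : OnePoint ℚ) : OnePoint ℚ := moebius γ r

lemma act_mul (γ δ : Shat) (r : OnePoint ℚ) : act (γ * δ) r = act γ (act δ r) := by
  simp [act]

@[simp] lemma act_one (r : OnePoint ℚ) : act (1 : Shat) r = r := by simp [act]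

@[simp] lemma act_inv_act (γ : Shat) (r : OnePoint ℚ) : act γ⁻¹ (act γ r) = r := by
  rw [← act_mul, inv_mul_cancel, act_one]

@[simp] lemma act_act_inv (γ : Shat) (r : OnePoint ℚ) : act γ (act γ⁻¹ r) = r := by
  rw [← act_mul, mul_inv_cancel, act_one]

lemma act_injective (γ : Shat) : Function.Injective (act γ) :=
  Function.LeftInverse.injective (act_inv_act γ)

lemma FareyAdj.act {r s : OnePoint ℚ} (h : FareyAdj r s) (γ : Shat) :
    FareyAdj (act γ r) (act γ s) := h.moebius γ

namespace IsNeumann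

variable (hN : IsNeumann Shat)

/-- The element of a Neumann subgroup taking `∞` to `r`. -/
noncomputable def elt (r : OnePoint ℚ) : Shat := ⟨(hN r).choose, (hN r).choose_spec.1.1⟩

lemma act_elt (r : OnePoint ℚ) : act (hN.elt r) OnePoint.infty = r := (hN r).choose_spec.1.2

include hN in
lemma eq_of_act {γ δ : Shat} (h : act γ OnePoint.infty = act δ OnePoint.infty) : γ = δ := by
  obtain ⟨x, -, hx⟩ := hN (act δ OnePoint.infty)
  exact Subtype.ext ((hx γ ⟨γ.2, h⟩).trans (hx δ ⟨δ.2, rfl⟩).symm)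

lemma act_inv_elt (r : OnePoint ℚ) : act (hN.elt r)⁻¹ r = OnePoint.infty := by
  have h := act_inv_act (hN.elt r) OnePoint.infty
  rwa [act_elt] at h

lemma eq_elt {γ : Shat} {r : OnePoint ℚ} (h : act γ OnePoint.infty = r) : hN.elt r = γ :=
  hN.eq_of_act (by rw [act_elt, h])

include hN in
/-- A Neumann subgroup acts freely on the cusps. -/
lemma eq_one_of_act_eq {γ : Shat} {r : OnePoint ℚ} (h : act γ r = r) : γ = 1 := by
  have h1 : γ * hN.elt r = hN.elt r := hN.eq_of_act (by rw [act_mul, act_elt, h])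
  simpa using h1

/-- The element taking `∞` to the other end of the edge of the flag `f`. -/
noncomputable def flagElt (f : ℤ) : Shat := hN.elt (flagCusp f)

lemma act_flagElt (f : ℤ) : act (hN.flagElt f) OnePoint.infty = flagCusp f := hN.act_elt _

lemma act_inv_flagElt (f : ℤ) : act (hN.flagElt f)⁻¹ (flagCusp f) = OnePoint.infty := by
  rw [← hN.act_flagElt, act_inv_act]

lemma exists_flip (f : ℤ) : ∃ f', flagCusp f' = act (hN.flagElt f)⁻¹ OnePoint.infty ∧
    flagCusp (turn f') = act (hN.flagElt f)⁻¹ (flagCusp (turn f)) := by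
  apply exists_flag
  · have := ((fareyAdj_flagCusp f).symm).act (hN.flagElt f)⁻¹
    rwa [act_inv_flagElt] at this
  · have := (fareyAdj_turn f).act (hN.flagElt f)⁻¹
    rwa [act_inv_flagElt] at this
  · exact (fareyAdj_flagCusp (turn f)).act (hN.flagElt f)⁻¹

/-- The flag at `∞` obtained from `f` by viewing its edge and triangle from the other end
and moving this end to `∞` by the action of the group. -/
noncomputable def flip (f : ℤ) : ℤ := (hN.exists_flip f).choose

lemma flagCusp_flip (f : ℤ) :
    flagCusp (hN.flip f) = act (hN.flagElt f)⁻¹ OnePoint.infty := (hN.exists_flip f).choose_spec.1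

lemma flagCusp_turn_flip (f : ℤ) : flagCusp (turn (hN.flip f)) =
    act (hN.flagElt f)⁻¹ (flagCusp (turn f)) := (hN.exists_flip f).choose_spec.2

lemma flagElt_flip (f : ℤ) : hN.flagElt (hN.flip f) = (hN.flagElt f)⁻¹ :=
  hN.eq_elt (hN.flagCusp_flip f).symm

lemma flagElt_cross (f : ℤ) : hN.flagElt (cross f) = hN.flagElt f := by simp [flagElt]

lemma flip_flip (f : ℤ) : hN.flip (hN.flip f) = f := by
  apply flag_ext
  · rw [flagCusp_flip, flagElt_flip, inv_inv, act_flagElt]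
  · rw [flagCusp_turn_flip, flagElt_flip, inv_inv, flagCusp_turn_flip, act_act_inv]

lemma flagElt_turn (f : ℤ) :
    hN.flagElt (turn f) = hN.flagElt f * hN.flagElt (turn (hN.flip f)) :=
  hN.eq_elt (by rw [act_mul, act_flagElt, flagCusp_turn_flip, act_act_inv])

lemma flip_ne (f : ℤ) : hN.flip f ≠ f := by
  intro h
  have h1 := hN.flagCusp_turn_flip f
  rw [h] at h1
  have h2 : (hN.flagElt f)⁻¹ = 1 := hN.eq_one_of_act_eq h1.symm
  have h3 := hN.act_flagElt f
  rw [inv_eq_one.1 h2, act_one] at h3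
  exact flagCusp_ne_infty f h3.symm

lemma flip_cross (f : ℤ) : hN.flip (cross f) = cross (hN.flip f) := by
  have h1 : flagCusp (hN.flip (cross f)) = flagCusp (hN.flip f) := by
    rw [flagCusp_flip, flagCusp_flip, flagElt_cross]
  rcases eq_or_eq_cross h1 with h2 | h2
  · have h3 := congrArg hN.flip h2
    rw [flip_flip, flip_flip] at h3
    exact absurd h3 (cross_ne f)
  · exact h2

lemma flip_braid (f : ℤ) :
    hN.flip (turn (hN.flip f)) = turn (hN.flip (turn f)) := by
  have h1 : (hN.flagElt (turn (hN.flip f)))⁻¹ = (hN.flagElt (turn f))⁻¹ * hN.flagElt f := by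
    rw [flagElt_turn hN f]
    group
  apply flag_ext
  · rw [flagCusp_flip, h1, act_mul, act_flagElt, flagCusp_turn_flip, turn_turn]
  · rw [flagCusp_turn_flip, turn_turn, turn_turn, h1, act_mul, flagCusp_flip, act_act_inv,
      flagCusp_flip]

lemma closure_flagElt : Subgroup.closure (Set.range hN.flagElt) = ⊤ := by
  have key : ∀ r, hN.elt r ∈ Subgroup.closure (Set.range hN.flagElt) := by
    refine farey_induction ?_ ?_
    · rw [hN.eq_elt (act_one _)]
      exact one_mem _
    · intro r s hrs hr
      have h1 := hrs.act (hN.elt r)⁻¹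
      rw [act_inv_elt] at h1
      obtain ⟨n, hn⟩ := h1.exists_int
      rw [← flagCusp_two_mul] at hn
      have h3 : hN.elt s = hN.elt r * hN.flagElt (2 * n) :=
        hN.eq_elt (by rw [act_mul, act_flagElt, ← hn, act_act_inv])
      rw [h3]
      exact mul_mem hr (Subgroup.subset_closure ⟨_, rfl⟩)
  rw [eq_top_iff]
  intro γ _
  rw [← hN.eq_elt (γ := γ) rfl]
  exact key _

/-- The triangle relations define a multiplicative function on the directed edges, invariant under
the group; its potential is a homomorphism, as `Ŝ` is identified with the set of cusps. -/
lemma exists_lift {K : Type} [Group K] (k : ℤ → K) (h1 : ∀ f, k (cross f) = k f)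
    (h2 : ∀ f, k (hN.flip f) = (k f)⁻¹)
    (h3 : ∀ f, k (turn f) = k f * k (turn (hN.flip f))) :
    ∃ φ : Shat →* K, ∀ f, φ (hN.flagElt f) = k f := by
  let F : OnePoint ℚ → OnePoint ℚ → K := fun r s => k (2 * cuspNum (act (hN.elt r)⁻¹ s))
  have hF : ∀ r s f, act (hN.elt r)⁻¹ s = flagCusp f → F r s = k f := by
    intro r s f h
    simp only [F, h]
    have h4 : flagCusp (2 * cuspNum (flagCusp f)) = flagCusp f := by
      rw [flagCusp_two_mul, cuspNum_flagCusp]; rfl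
    rcases eq_or_eq_cross h4 with h5 | h5 <;> rw [h5]
    exact h1 f
  have hadj : ∀ r s, FareyAdj r s → FareyAdj OnePoint.infty (act (hN.elt r)⁻¹ s) := by
    intro r s h
    have h4 := h.act (hN.elt r)⁻¹
    rwa [act_inv_elt] at h4
  have helt : ∀ r s f, act (hN.elt r)⁻¹ s = flagCusp f →
      hN.elt s = hN.elt r * hN.flagElt f := by
    intro r s f h
    exact hN.eq_elt (by rw [act_mul, act_flagElt, ← h, act_act_inv])
  obtain ⟨κ, κ0, hκ⟩ := exists_farey_potential F (by
      intro r s hrs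
      obtain ⟨n, hn⟩ := (hadj r s hrs).exists_int
      rw [← flagCusp_two_mul] at hn
      have h5 : act (hN.elt s)⁻¹ r = flagCusp (hN.flip (2 * n)) := by
        rw [helt r s _ hn, mul_inv_rev, act_mul, act_inv_elt, flagCusp_flip]
      rw [hF r s _ hn, hF s r _ h5, h2, mul_inv_cancel]) (by
      intro r s t hrs hst hrt
      obtain ⟨f, hf, hf'⟩ := exists_flag (hadj r s hrs) (hadj r t hrt) (hst.act _)
      have h5 : act (hN.elt s)⁻¹ t = flagCusp (turn (hN.flip f)) := by
        rw [helt r s f hf.symm, mul_inv_rev, act_mul, ← hf', flagCusp_turn_flip]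
      rw [hF r s f hf.symm, hF r t _ hf'.symm, hF s t _ h5, ← h3])
  have hFinv : ∀ (γ : Shat) r s, F (act γ r) (act γ s) = F r s := by
    intro γ r s
    have : hN.elt (act γ r) = γ * hN.elt r := hN.eq_elt (by rw [act_mul, act_elt])
    simp only [F, this, mul_inv_rev, act_mul, act_inv_act]
  have hmul : ∀ (γ : Shat) s, κ (act γ s) = κ (act γ OnePoint.infty) * κ s := by
    intro γ
    refine farey_induction (by rw [κ0, mul_one]) ?_
    intro r s hrs hr
    rw [hκ _ _ (hrs.act γ), hFinv, hκ _ _ hrs, hr, mul_assoc]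
  refine ⟨⟨⟨fun γ => κ (act γ OnePoint.infty), by simp [κ0]⟩, fun γ δ => ?_⟩, fun f => ?_⟩
  · simp only [act_mul]
    exact hmul _ _
  · change κ (act (hN.flagElt f) OnePoint.infty) = k f
    rw [act_flagElt, hκ _ _ (fareyAdj_flagCusp f), κ0, one_mul]
    apply hF
    rw [hN.eq_elt (act_one _), inv_one, act_one]

/-- A Neumann subgroup is presented by its elements `flagElt f`. -/
lemma isFlagSystem : IsFlagSystem hN.flip hN.flagElt where
  invol := hN.flip_flip
  ne := hN.flip_ne
  comm := hN.flip_cross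
  braid := hN.flip_braid
  w_cross := hN.flagElt_cross
  w_invol := hN.flagElt_flip
  w_turn := hN.flagElt_turn
  closure_range := hN.closure_flagElt
  exists_lift _ _ k h1 h2 h3 := hN.exists_lift k h1 h2 h3

end IsNeumann

end

/-! ### Neumann subgroups are not finitely generated -/

section

variable {Shat : Subgroup PGL(2, ℤ)}

/-- The cusp `r` lies in `[M, ∞]`. -/
def InRay (M : ℤ) (r : OnePoint ℚ) : Prop := M * cuspDen r ≤ cuspNum r

/-- The vertices of the Farey triangle `∞, n, n + 1`. -/
def fan (n : ℤ) : Set (OnePoint ℚ) :=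
  {OnePoint.infty, ((n : ℚ) : OnePoint ℚ), (((n + 1 : ℤ) : ℚ) : OnePoint ℚ)}

/-- Farey edges do not cross: an edge that leaves `[M, ∞]` ends at `M` or `∞`. -/
lemma FareyAdj.eq_of_not_inRay {M : ℤ} {r u : OnePoint ℚ} (h : FareyAdj r u) (hr : InRay M r)
    (hu : ¬ InRay M u) : r = OnePoint.infty ∨ r = ((M : ℚ) : OnePoint ℚ) := by
  by_cases hr0 : r = OnePoint.infty
  · exact Or.inl hr0
  right
  have h1 := cuspDen_nonneg r
  have h2 := cuspDen_nonneg u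
  have h3 : cuspDen r ≠ 0 := fun h => hr0 (cuspDen_eq_zero.1 h)
  have h4 : cuspDen u ≠ 0 := fun h => hu (by rw [cuspDen_eq_zero.1 h]; simp [InRay])
  unfold InRay at hr hu
  -- `a` and `b` measure the positions of the two ends relative to `M`
  obtain ⟨a, ha⟩ : ∃ a, a = cuspNum r - M * cuspDen r := ⟨_, rfl⟩
  obtain ⟨b, hb⟩ : ∃ b, b = M * cuspDen u - cuspNum u := ⟨_, rfl⟩
  have h5 : cuspDet r u = a * cuspDen u + b * cuspDen r := by rw [cuspDet, ha, hb]; ring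
  have ha0 : 0 ≤ a := by linarith
  have hb0 : 1 ≤ b := by linarith
  have hu1 : 1 ≤ cuspDen u := by omega
  have hr1 : 1 ≤ cuspDen r := by omega
  have h6 : a * cuspDen u + b * cuspDen r = 1 := by
    have h7 : 0 ≤ a * cuspDen u + b * cuspDen r := by positivity
    unfold FareyAdj at h
    rw [h5] at h
    omega
  have h8 : a = 0 := by nlinarith
  have h9 : cuspDen r = 1 := by
    rw [h8, zero_mul, zero_add] at h6
    exact Int.eq_one_of_mul_eq_one_left h1 h6
  exact cusp_ext (by rw [h8, h9] at ha; simp; linarith) (by simp [h9])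

/-- Of two triangles with a common edge, if exactly the first one lies in `[M, ∞]`, then it is the
triangle `∞, M, M + 1`. -/
lemma mem_fan_of_crossing {M : ℤ} {p q u v : OnePoint ℚ} (hpq : FareyAdj p q) (hup : FareyAdj p u)
    (huq : FareyAdj q u) (hvp : FareyAdj p v) (hvq : FareyAdj q v) (hp : InRay M p)
    (hq : InRay M q) (hv : InRay M v) (hu : ¬ InRay M u) : p ∈ fan M ∧ q ∈ fan M ∧ v ∈ fan M := by
  have hne : p ≠ q := by
    rintro rfl
    simp [FareyAdj, cuspDet] at hpq
  have key : ∀ v : OnePoint ℚ, FareyAdj OnePoint.infty v → FareyAdj ((M : ℚ) : OnePoint ℚ) v →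
      InRay M v → v ∈ fan M := by
    intro v h1 h2 h3
    obtain ⟨m, rfl⟩ := h1.exists_int
    simp only [FareyAdj, cuspDet, InRay, cuspNum_coe, cuspDen_coe, Rat.num_intCast,
      Rat.den_intCast] at h2 h3
    push_cast at h2 h3
    have : m = M + 1 := by omega
    simp [fan, this]
  rcases hup.eq_of_not_inRay hp hu with rfl | rfl <;>
    rcases huq.eq_of_not_inRay hq hu with rfl | rfl
  · exact absurd rfl hne
  · exact ⟨by simp [fan], by simp [fan], key v hvp hvq hv⟩
  · exact ⟨by simp [fan], by simp [fan], key v hvq hvp hv⟩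
  · exact absurd rfl hne

lemma fan_adj (n : ℤ) : FareyAdj OnePoint.infty ((n : ℚ) : OnePoint ℚ) ∧
    FareyAdj ((n : ℚ) : OnePoint ℚ) (((n + 1 : ℤ) : ℚ) : OnePoint ℚ) := by
  refine ⟨fareyAdj_infty_int n, ?_⟩
  simp only [FareyAdj, cuspDet, cuspNum_coe, cuspDen_coe, Rat.num_intCast, Rat.den_intCast]
  push_cast
  omega

/-- The translate of the triangle `∞, n, n + 1` by `γ` lies in `[M, ∞]`. -/
def FanInRay (M : ℤ) (γ : Shat) (n : ℤ) : Prop := ∀ r ∈ fan n, InRay M (act γ r)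

lemma fanInRay_iff {M : ℤ} {γ : Shat} {n : ℤ} : FanInRay M γ n ↔
    InRay M (act γ OnePoint.infty) ∧ InRay M (act γ ((n : ℚ) : OnePoint ℚ)) ∧
      InRay M (act γ (((n + 1 : ℤ) : ℚ) : OnePoint ℚ)) := by
  simp [FanInRay, fan]

/-- The vertices of the triangle of the flag `f`. -/
lemma fan_flag (f : ℤ) : fan (f / 2) = {OnePoint.infty, flagCusp f, flagCusp (turn f)} := by
  by_cases hf : f % 2 = 0
  · have h1 : (f + 1) / 2 = f / 2 := by omega
    have h2 : (f + 1 + 1) / 2 = f / 2 + 1 := by omega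
    simp only [fan, flagCusp, turn, hf, if_true, h1, h2]
  · have h1 : (f + 1) / 2 = f / 2 + 1 := by omega
    have h2 : (f - 1 + 1) / 2 = f / 2 := by omega
    simp only [fan, flagCusp, turn, hf, if_false, h1, h2]
    rw [Set.pair_comm]

/-- Within a range of triangles at `∞` none of whose translates by `γ` is the triangle
`∞, M, M + 1`, either all translates lie in `[M, ∞]` or none does. -/
lemma fanInRay_succ {M : ℤ} {γ : Shat} {n : ℤ} (h : ¬ ∀ r ∈ fan n, act γ r ∈ fan M)
    (h' : ¬ ∀ r ∈ fan (n + 1), act γ r ∈ fan M) : FanInRay M γ n ↔ FanInRay M γ (n + 1) := by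
  obtain ⟨a1, a2⟩ := fan_adj n
  obtain ⟨a3, a4⟩ := fan_adj (n + 1)
  obtain ⟨a5, -⟩ := fan_adj (n + 1 + 1)
  rw [fanInRay_iff, fanInRay_iff]
  refine ⟨fun ⟨h1, h2, h3⟩ => ⟨h1, h3, ?_⟩, fun ⟨h1, h2, h3⟩ => ⟨h1, ?_, h2⟩⟩
  · by_contra h4
    obtain ⟨h5, h6, h7⟩ := mem_fan_of_crossing (a3.act γ) (a5.act γ) (a4.act γ) (a1.act γ)
      (a2.symm.act γ) h1 h3 h2 h4
    refine h ?_
    rintro r (rfl | rfl | rfl) <;> assumption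
  · by_contra h4
    obtain ⟨h5, h6, h7⟩ := mem_fan_of_crossing (a3.act γ) (a1.act γ) (a2.symm.act γ) (a5.act γ)
      (a4.act γ) h1 h2 h3 h4
    refine h' ?_
    rintro r (rfl | rfl | rfl) <;> assumption

lemma fan_finite (n : ℤ) : (fan n).Finite := by simp [fan]

/-- A translate of a triangle contained in `fan M` is equal to it, so it has the vertices
`∞` and `M`. -/
lemma int_mem_image_of_subset_fan {M n : ℤ} {γ : Shat} (h : ∀ r ∈ fan n, act γ r ∈ fan M) :
    (∃ r ∈ fan n, act γ r = OnePoint.infty) ∧ ∃ r ∈ fan n, act γ r = ((M : ℚ) : OnePoint ℚ) := by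
  have h3 : ∀ m, (fan m).ncard = 3 := fun m => by
    rw [fan, Set.ncard_eq_three]
    refine ⟨_, _, _, ?_, ?_, ?_, rfl⟩
    · exact (OnePoint.coe_ne_infty _).symm
    · exact (OnePoint.coe_ne_infty _).symm
    · intro h
      have := congrArg cuspNum h
      simp only [cuspNum_coe, Rat.num_intCast] at this
      omega
  have h4 : act γ '' fan n = fan M := by
    refine Set.eq_of_subset_of_ncard_le (Set.image_subset_iff.2 h) ?_ (fan_finite M)
    rw [Set.ncard_image_of_injective _ (act_injective γ), h3, h3]
  have h5 : OnePoint.infty ∈ act γ '' fan n := by rw [h4]; simp [fan]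
  have h6 : ((M : ℚ) : OnePoint ℚ) ∈ act γ '' fan n := by rw [h4]; simp [fan]
  exact ⟨h5, h6⟩

namespace IsNeumann

variable (hN : IsNeumann Shat)
include hN

/-- Only finitely many of the triangles `∞, M, M + 1` are translates of a triangle `∞, n, n + 1`
with `|n| ≤ N`. -/
lemma exists_not_subset_fan (N : ℕ) :
    ∃ M : ℤ, 0 < M ∧ ∀ (γ : Shat) (n : ℤ), |n| ≤ N → ¬ ∀ r ∈ fan n, act γ r ∈ fan M := by
  let V : Set (OnePoint ℚ) := ⋃ n ∈ Set.Icc (-N : ℤ) N, fan n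
  have hV : V.Finite := (Set.finite_Icc _ _).biUnion fun n _ => fan_finite n
  have hB : (Set.image2 (fun v v' => cuspNum (act (hN.elt v)⁻¹ v')) V V).Finite :=
    hV.image2 _ hV
  obtain ⟨M, hM, hM'⟩ := (Set.Ioi_infinite (0 : ℤ)).exists_notMem_finite hB
  refine ⟨M, hM, fun γ n hn h => hM' ?_⟩
  obtain ⟨⟨v, hv, h1⟩, v', hv', h2⟩ := int_mem_image_of_subset_fan h
  have hn' : n ∈ Set.Icc (-N : ℤ) N := by rwa [Set.mem_Icc, ← abs_le]
  have h3 : hN.elt v = γ⁻¹ := hN.eq_elt (by rw [← h1, act_inv_act])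
  refine ⟨v, Set.mem_biUnion hn' hv, v', Set.mem_biUnion hn' hv', ?_⟩
  simp [h3, h2]

/-- Finitely many of the elements `flagElt f` do not generate a Neumann subgroup. Let the triangles
`∞, n, n + 1` with `|n| ≤ N` include those of the flags `f` and `flip f` for these generators, and
let no translate of them be the triangle `∞, M, M + 1`, where `0 < M`. Then whether the translates
by `γ` of these triangles lie in `[M, ∞]` does not depend on the triangle, and is not changed when
`γ` is multiplied on the right by a generator. But for `γ = 1` the triangle `∞, 0, 1` does not lie
in `[M, ∞]`, whereas all triangles at the cusp `M + 1` do. -/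
lemma closure_ne_top {A : Set ℤ} (hA : A.Finite) : Subgroup.closure (hN.flagElt '' A) ≠ ⊤ := by
  intro htop
  have hA' : ((fun f => (f / 2).natAbs) '' (A ∪ hN.flip '' A)).Finite :=
    (hA.union (hA.image _)).image _
  obtain ⟨N, hNb⟩ := hA'.bddAbove
  have hbound : ∀ f ∈ A ∪ hN.flip '' A, |f / 2| ≤ N := fun f hf => by
    have := hNb ⟨f, hf, rfl⟩
    rw [Int.abs_eq_natAbs]
    exact_mod_cast this
  obtain ⟨M, hM0, hM⟩ := hN.exists_not_subset_fan N
  have hstep : ∀ (γ : Shat) (k : ℕ), k ≤ N → (FanInRay M γ k ↔ FanInRay M γ 0) ∧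
      (FanInRay M γ (-k) ↔ FanInRay M γ 0) := by
    intro γ k
    induction k with
    | zero => simp
    | succ k ih =>
      intro hk
      obtain ⟨h1, h2⟩ := ih (by omega)
      constructor
      · rw [← h1]
        push_cast
        exact (fanInRay_succ (hM γ _ (by rw [abs_le]; omega)) (hM γ _ (by rw [abs_le]; omega))).symm
      · rw [← h2]
        have h3 := fanInRay_succ (M := M) (γ := γ) (n := -((k + 1 : ℕ) : ℤ))
          (hM γ _ (by rw [abs_le]; omega)) (hM γ _ (by rw [abs_le]; omega))
        rwa [show -((k + 1 : ℕ) : ℤ) + 1 = -k by push_cast; ring] at h3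
  have hconst : ∀ (γ : Shat) (n : ℤ), |n| ≤ N → (FanInRay M γ n ↔ FanInRay M γ 0) := by
    intro γ n hn
    rw [abs_le] at hn
    rcases le_total 0 n with h | h
    · obtain ⟨k, rfl⟩ := Int.eq_ofNat_of_zero_le h
      exact (hstep γ k (by omega)).1
    · obtain ⟨k, hk⟩ := Int.exists_eq_neg_ofNat h
      rw [hk]
      exact (hstep γ k (by omega)).2
  have hmul : ∀ (γ : Shat) (f : ℤ), |f / 2| ≤ N → |hN.flip f / 2| ≤ N →
      (FanInRay M (γ * hN.flagElt f) 0 ↔ FanInRay M γ 0) := by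
    intro γ f h1 h2
    rw [← hconst γ _ h1, ← hconst _ _ h2]
    unfold FanInRay
    rw [fan_flag, fan_flag]
    simp only [Set.mem_insert_iff, Set.mem_singleton_iff, forall_eq_or_imp, forall_eq, act_mul,
      act_flagElt, flagCusp_flip, flagCusp_turn_flip, act_act_inv]
    tauto
  have hall : ∀ δ γ : Shat, FanInRay M (γ * δ) 0 ↔ FanInRay M γ 0 := by
    intro δ
    have hδ : δ ∈ Subgroup.closure (hN.flagElt '' A) := by rw [htop]; trivial
    induction hδ using Subgroup.closure_induction with
    | mem δ hδ =>
      obtain ⟨f, hf, rfl⟩ := hδ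
      exact fun γ => hmul γ f (hbound f (Or.inl hf)) (hbound _ (Or.inr ⟨f, hf, rfl⟩))
    | one => simp
    | mul a b _ _ ha hb =>
      intro γ
      rw [← mul_assoc, hb, ha]
    | inv a _ ha =>
      intro γ
      rw [← ha, inv_mul_cancel_right]
  have h1 := hall (hN.elt (((M + 1 : ℤ) : ℚ) : OnePoint ℚ)) 1
  rw [one_mul, fanInRay_iff, fanInRay_iff] at h1
  have h2 : ¬ InRay M (((0 : ℤ) : ℚ) : OnePoint ℚ) := by
    simp [InRay, hM0]
  have hM1 : InRay M (((M + 1 : ℤ) : ℚ) : OnePoint ℚ) := by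
    simp only [InRay, cuspNum_coe, cuspDen_coe, Rat.num_intCast, Rat.den_intCast]
    push_cast
    omega
  have h3 : ∀ r, FareyAdj (((M + 1 : ℤ) : ℚ) : OnePoint ℚ) r → InRay M r := by
    intro r hr
    by_contra h4
    rcases hr.eq_of_not_inRay hM1 h4 with h5 | h5
    · exact OnePoint.coe_ne_infty _ h5
    · have := congrArg cuspNum h5
      simp only [cuspNum_coe, Rat.num_intCast] at this
      omega
  have hadj : ∀ n : ℤ, InRay M (act (hN.elt (((M + 1 : ℤ) : ℚ) : OnePoint ℚ))
      ((n : ℚ) : OnePoint ℚ)) := by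
    intro n
    have h4 := (fareyAdj_infty_int n).act (hN.elt (((M + 1 : ℤ) : ℚ) : OnePoint ℚ))
    rw [act_elt] at h4
    exact h3 _ h4
  have h5 := (h1.1 ⟨by rwa [act_elt], hadj 0, hadj (0 + 1)⟩).2.1
  rw [act_one] at h5
  exact h2 h5

/-- A Neumann subgroup is not finitely generated, since finitely many elements lie in the subgroup
generated by finitely many of the elements `flagElt f`. -/
lemma not_fg {X : Set Shat} (hX : X.Finite) : Subgroup.closure X ≠ ⊤ := by
  intro htop
  have key : ∀ γ : Shat, ∃ A : Set ℤ, A.Finite ∧ γ ∈ Subgroup.closure (hN.flagElt '' A) := by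
    intro γ
    have hγ : γ ∈ Subgroup.closure (Set.range hN.flagElt) := by
      rw [hN.closure_flagElt]; trivial
    have mono : ∀ A B : Set ℤ, A ⊆ B →
        Subgroup.closure (hN.flagElt '' A) ≤ Subgroup.closure (hN.flagElt '' B) :=
      fun A B h => Subgroup.closure_mono (Set.image_mono h)
    induction hγ using Subgroup.closure_induction with
    | mem γ hγ =>
      obtain ⟨f, rfl⟩ := hγ
      exact ⟨{f}, Set.finite_singleton f, Subgroup.subset_closure ⟨f, rfl, rfl⟩⟩
    | one => exact ⟨∅, Set.finite_empty, one_mem _⟩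
    | mul a b _ _ ha hb =>
      obtain ⟨A, hA, ha⟩ := ha
      obtain ⟨B, hB, hb⟩ := hb
      exact ⟨A ∪ B, hA.union hB, mul_mem (mono _ _ Set.subset_union_left ha)
        (mono _ _ Set.subset_union_right hb)⟩
    | inv a _ ha =>
      obtain ⟨A, hA, ha⟩ := ha
      exact ⟨A, hA, inv_mem ha⟩
  choose A hA hmem using key
  refine hN.closure_ne_top (hX.biUnion fun x _ => hA x) ?_
  rw [eq_top_iff, ← htop, Subgroup.closure_le]
  intro x hx
  exact Subgroup.closure_mono (Set.image_mono (Set.subset_biUnion_of_mem (u := A) hx)) (hmem x)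

end IsNeumann

end

/-! ### Elements of order two and three -/

section

lemma det_mk (A : GL (Fin 2) ℤ) :
    det (Matrix.ProjGenLinGroup.mk A) = Matrix.GeneralLinearGroup.det A := rfl

lemma mem_modularGroup_iff {α : PGL(2, ℤ)} : α ∈ modularGroup ↔ det α = 1 := by
  constructor
  · rintro ⟨β, rfl⟩
    obtain ⟨B, rfl⟩ := QuotientGroup.mk_surjective β
    change Matrix.GeneralLinearGroup.det (B : GL (Fin 2) ℤ) = 1
    ext
    simp
  · intro h
    obtain ⟨A, rfl⟩ := Matrix.ProjGenLinGroup.mk_surjective α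
    rw [det_mk] at h
    have h1 : (A.val).det = 1 := by
      rw [← Matrix.GeneralLinearGroup.val_det_apply, h]; rfl
    let B : SL(2, ℤ) := ⟨A.val, h1⟩
    refine ⟨QuotientGroup.mk B, ?_⟩
    change Matrix.ProjGenLinGroup.mk (B : GL (Fin 2) ℤ) = _
    congr 1
    ext i j
    rfl

lemma scalar_val (u : ℤˣ) (i j : Fin 2) :
    (Matrix.GeneralLinearGroup.scalar (Fin 2) u).val i j = if i = j then (u : ℤ) else 0 := by
  rcases Int.units_eq_one_or u with rfl | rfl <;> fin_cases i <;> fin_cases j <;> rfl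

lemma entries_of_mk_eq_one {A : GL (Fin 2) ℤ} (h : Matrix.ProjGenLinGroup.mk A = 1) :
    A.val 0 1 = 0 ∧ A.val 1 0 = 0 ∧ A.val 0 0 = A.val 1 1 := by
  rw [← map_one Matrix.ProjGenLinGroup.mk, eq_comm, Matrix.ProjGenLinGroup.mk_eq_mk_iff] at h
  obtain ⟨u, rfl⟩ := h
  simp only [one_mul, scalar_val]
  simp

lemma mk_eq_one_of_entries {A : GL (Fin 2) ℤ} (h1 : A.val 0 1 = 0) (h2 : A.val 1 0 = 0)
    (h3 : A.val 0 0 = A.val 1 1) : Matrix.ProjGenLinGroup.mk A = 1 := by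
  have hdet : A.val 0 0 * A.val 0 0 = (A.det : ℤˣ) := by
    rw [Matrix.GeneralLinearGroup.val_det_apply, Matrix.det_fin_two, h1, h3]
    ring
  have hu : IsUnit (A.val 0 0) := isUnit_of_mul_isUnit_left (hdet ▸ Units.isUnit _)
  obtain ⟨u, hu⟩ := hu
  have : A = Matrix.GeneralLinearGroup.scalar (Fin 2) u := by
    ext i j
    fin_cases i <;> fin_cases j <;> simp [h1, h2, ← h3, scalar_val, hu]
  rw [this, Matrix.ProjGenLinGroup.mk_scalar]

lemma val_det (A : GL (Fin 2) ℤ) :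
    ((det (Matrix.ProjGenLinGroup.mk A) : ℤˣ) : ℤ) =
      A.val 0 0 * A.val 1 1 - A.val 0 1 * A.val 1 0 := by
  rw [det_mk, Matrix.GeneralLinearGroup.val_det_apply, Matrix.det_fin_two]

/-- By the Cayley–Hamilton theorem `A * A = tr A • A - det A`, which for non-scalar `A` is
scalar only if the trace vanishes. -/
lemma trace_eq_zero_of_orderOf {A : GL (Fin 2) ℤ}
    (h : orderOf (Matrix.ProjGenLinGroup.mk A) = 2) : A.val 0 0 + A.val 1 1 = 0 := by
  have h1 : Matrix.ProjGenLinGroup.mk (A * A) = 1 := by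
    have h2 := pow_orderOf_eq_one (Matrix.ProjGenLinGroup.mk A)
    rwa [h, pow_two] at h2
  obtain ⟨e1, e2, e3⟩ := entries_of_mk_eq_one h1
  simp only [Units.val_mul, Matrix.mul_apply, Fin.sum_univ_two] at e1 e2 e3
  by_contra hne
  have f1 : A.val 0 1 = 0 := (mul_eq_zero.1 (by linarith :
    (A.val 0 0 + A.val 1 1) * A.val 0 1 = 0)).resolve_left hne
  have f2 : A.val 1 0 = 0 := (mul_eq_zero.1 (by linarith :
    (A.val 0 0 + A.val 1 1) * A.val 1 0 = 0)).resolve_left hne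
  have f3 : A.val 0 0 - A.val 1 1 = 0 := (mul_eq_zero.1 (by linarith :
    (A.val 0 0 + A.val 1 1) * (A.val 0 0 - A.val 1 1) = 0)).resolve_left hne
  rw [mk_eq_one_of_entries f1 f2 (by linarith), orderOf_one] at h
  exact absurd h (by decide)

/-- By the Cayley–Hamilton theorem `A ^ 3` differs from `((tr A) ^ 2 - det A) • A` by a scalar. -/
lemma trace_sq_of_orderOf {A : GL (Fin 2) ℤ}
    (h : orderOf (Matrix.ProjGenLinGroup.mk A) = 3)
    (hd : det (Matrix.ProjGenLinGroup.mk A) = 1) : (A.val 0 0 + A.val 1 1) ^ 2 = 1 := by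
  have h1 : Matrix.ProjGenLinGroup.mk (A * A * A) = 1 := by
    have h2 := pow_orderOf_eq_one (Matrix.ProjGenLinGroup.mk A)
    rwa [h, pow_succ, pow_two] at h2
  obtain ⟨e1, e2, e3⟩ := entries_of_mk_eq_one h1
  have hdet := val_det A
  rw [hd] at hdet
  simp only [Units.val_mul, Matrix.mul_apply, Fin.sum_univ_two, Units.val_one] at e1 e2 e3 hdet
  set a := A.val 0 0
  set b := A.val 0 1
  set c := A.val 1 0
  set d := A.val 1 1
  by_contra hne
  have hne' : (a + d) ^ 2 - 1 ≠ 0 := fun h => hne (by linarith)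
  have f1 : b = 0 := (mul_eq_zero.1 (by linear_combination e1 - b * hdet :
    ((a + d) ^ 2 - 1) * b = 0)).resolve_left hne'
  have f2 : c = 0 := (mul_eq_zero.1 (by linear_combination e2 - c * hdet :
    ((a + d) ^ 2 - 1) * c = 0)).resolve_left hne'
  have f3 : a - d = 0 := (mul_eq_zero.1 (by linear_combination e3 - (a - d) * hdet :
    ((a + d) ^ 2 - 1) * (a - d) = 0)).resolve_left hne'
  rw [mk_eq_one_of_entries f1 f2 (by linarith), orderOf_one] at h
  exact absurd h (by decide)

/-- A reflection fixes a cusp: its matrix has the rational eigenvalue `1`. -/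
lemma exists_fixed_cusp {A : GL (Fin 2) ℤ} (htr : A.val 0 0 + A.val 1 1 = 0)
    (hd : det (Matrix.ProjGenLinGroup.mk A) = -1) :
    ∃ r, moebius (Matrix.ProjGenLinGroup.mk A) r = r := by
  have hdet := val_det A
  rw [hd] at hdet
  change ∃ r, (Matrix.GeneralLinearGroup.map (Int.castRingHom ℚ) A) • r = r
  by_cases hc : A.val 1 0 = 0
  · exact ⟨OnePoint.infty, by simp [OnePoint.smul_infty_eq_ite, hc]⟩
  · have hd' : A.val 1 1 = - A.val 0 0 := by linarith
    rw [hd'] at hdet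
    have hc' : (A.val 1 0 : ℚ) ≠ 0 := by exact_mod_cast hc
    have hq : (A.val 0 0 : ℚ) * A.val 0 0 + A.val 0 1 * A.val 1 0 = 1 := by
      have : A.val 0 0 * A.val 0 0 + A.val 0 1 * A.val 1 0 = 1 := by
        simp at hdet
        linarith
      exact_mod_cast this
    refine ⟨(((1 + A.val 0 0) / A.val 1 0 : ℚ) : OnePoint ℚ), ?_⟩
    have e1 : (A.val 1 0 : ℚ) * ((1 + A.val 0 0) / A.val 1 0) + A.val 1 1 = 1 := by
      rw [hd']
      push_cast
      field_simp
      ring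
    have e2 : (A.val 0 0 : ℚ) * ((1 + A.val 0 0) / A.val 1 0) + A.val 0 1 =
        (1 + A.val 0 0) / A.val 1 0 := by
      field_simp
      linear_combination hq
    rw [OnePoint.smul_some_eq_ite]
    simp only [Matrix.GeneralLinearGroup.map_apply, eq_intCast]
    rw [e1, e2]
    simp

variable {Shat : Subgroup PGL(2, ℤ)}

/-- An involution of determinant `-1` fixes a cusp, but a Neumann subgroup acts freely on the
cusps. -/
lemma IsNeumann.det_eq_one_of_orderOf (hN : IsNeumann Shat) {γ : Shat} (h : orderOf γ = 2) :
    det (γ : PGL(2, ℤ)) = 1 := by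
  obtain ⟨A, hA⟩ := Matrix.ProjGenLinGroup.mk_surjective (γ : PGL(2, ℤ))
  rcases Int.units_eq_one_or (det (γ : PGL(2, ℤ))) with h1 | h1
  · exact h1
  · have h2 : orderOf (Matrix.ProjGenLinGroup.mk A) = 2 := by rw [hA, Subgroup.orderOf_coe, h]
    obtain ⟨r, hr⟩ := exists_fixed_cusp (trace_eq_zero_of_orderOf h2) (by rw [hA, h1])
    rw [hA] at hr
    have h3 : γ = 1 := hN.eq_one_of_act_eq hr
    rw [h3, orderOf_one] at h
    exact absurd h (by decide)

lemma IsNeumann.isElliptic (hN : IsNeumann Shat) {γ : Shat} (h : orderOf γ = 2 ∨ orderOf γ = 3) :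
    IsElliptic (γ : PGL(2, ℤ)) := by
  obtain ⟨A, hA⟩ := Matrix.ProjGenLinGroup.mk_surjective (γ : PGL(2, ℤ))
  have key : (A.val 0 0 + A.val 1 1) ^ 2 < 4 →
      det (Matrix.ProjGenLinGroup.mk A) = 1 → IsElliptic (γ : PGL(2, ℤ)) := by
    intro h1 h2
    refine ⟨A, hA, ?_⟩
    have h3 := val_det A
    rw [h2, Units.val_one] at h3
    rw [Matrix.IsElliptic, Matrix.discr_fin_two, Matrix.trace_fin_two, Matrix.det_fin_two, ← h3]
    linarith
  rcases h with h | h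
  · have h2 : orderOf (Matrix.ProjGenLinGroup.mk A) = 2 := by rw [hA, Subgroup.orderOf_coe, h]
    exact key (by rw [trace_eq_zero_of_orderOf h2]; norm_num)
      (by rw [hA, hN.det_eq_one_of_orderOf h])
  · have h2 : orderOf (Matrix.ProjGenLinGroup.mk A) = 3 := by rw [hA, Subgroup.orderOf_coe, h]
    have h3 : det (Matrix.ProjGenLinGroup.mk A) = 1 := by
      have h4 : det (Matrix.ProjGenLinGroup.mk A) ^ 3 = 1 := by
        rw [← map_pow, ← h2, pow_orderOf_eq_one, map_one]
      rcases Int.units_eq_one_or (det (Matrix.ProjGenLinGroup.mk A)) with h5 | h5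
      · exact h5
      · rw [h5] at h4
        exact absurd h4 (by decide)
    exact key (by rw [trace_sq_of_orderOf h2 h3]; norm_num) h3

end

/-! ### Independent generators of a Neumann subgroup -/

section Quotient

variable {H : Type} [Group H] {d : H →* ℤˣ}

lemma nonempty_quotient_ker_mulEquiv (hd : d ≠ 1) :
    Nonempty ((H ⧸ d.ker) ≃* Multiplicative (ZMod 2)) := by
  have hsurj : Function.Surjective d := by
    obtain ⟨g, hg⟩ : ∃ g, d g ≠ 1 := by
      by_contra! h
      exact hd (MonoidHom.ext h)
    intro u
    rcases Int.units_eq_one_or u with rfl | rfl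
    · exact ⟨1, map_one d⟩
    · exact ⟨g, (Int.units_eq_one_or _).resolve_left hg⟩
  have e : (H ⧸ d.ker) ≃* ℤˣ := QuotientGroup.quotientKerEquivOfSurjective d hsurj
  have : Fact (Nat.Prime 2) := ⟨Nat.prime_two⟩
  exact ⟨e.trans (mulEquivOfPrimeCardEq (p := 2) (by simp) (by simp))⟩

/-- A complement of `ker d` that is isomorphic to `C₂` is generated by an involution outside
`ker d`. -/
lemma not_isComplement'_ker (htor : ∀ g, orderOf g = 2 → d g = 1) {C : Subgroup H}
    (e : C ≃* Multiplicative (ZMod 2)) : ¬ Subgroup.IsComplement' d.ker C := by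
  intro hC
  let c : C := e.symm (Multiplicative.ofAdd 1)
  have hc : orderOf (c : H) = 2 := by
    rw [Subgroup.orderOf_coe, MulEquiv.orderOf_eq, orderOf_ofAdd_eq_addOrderOf,
      ZMod.addOrderOf_one]
  have h1 : (c : H) = 1 := Subgroup.disjoint_def.1 hC.disjoint (htor _ hc) c.2
  rw [h1, orderOf_one] at hc
  exact absurd hc (by decide)

end Quotient

lemma HasStructure.of_mulEquiv {H H' : Type} [Group H] [Group H'] {r₂ r₃ r : ℕ∞}
    (h : HasStructure H r₂ r₃ r) (e : H ≃* H') : HasStructure H' r₂ r₃ r := by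
  obtain ⟨X, hX, rfl, rfl, rfl⟩ := h
  simp only [numOfOrder_eq_encard]
  exact (hX.isFreeFamily.mulEquiv e).hasStructure fun x => hX.order x x.2

variable {Shat : Subgroup PGL(2, ℤ)}

/-- The determinant on a subgroup of `PGL(2, ℤ)`. -/
def sign (Shat : Subgroup PGL(2, ℤ)) : Shat →* ℤˣ :=
  det.comp Shat.subtype

lemma sign_ne_one (hM : ¬ Shat ≤ modularGroup) : sign Shat ≠ 1 := fun h =>
  hM fun α hα => mem_modularGroup_iff.2 (DFunLike.congr_fun h (⟨α, hα⟩ : Shat))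

lemma subgroupOf_eq_ker_sign (Shat : Subgroup PGL(2, ℤ)) :
    (Shat ⊓ modularGroup).subgroupOf Shat = (sign Shat).ker := by
  ext γ
  simp [Subgroup.mem_subgroupOf, mem_modularGroup_iff, MonoidHom.mem_ker, sign]

lemma numFreeOfDet_eq_encard (X : Set Shat) (ε : ℤˣ) :
    numFreeOfDet X ε = {x : X | orderOf (x : Shat) = 0 ∧ sign Shat x = ε}.encard := by
  rw [← Subtype.val_injective.encard_image, numFreeOfDet]
  congr 1
  ext y
  constructor
  · rintro ⟨h, h0, h1⟩
    exact ⟨⟨y, h⟩, ⟨h0, h1⟩, rfl⟩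
  · rintro ⟨x, ⟨h0, h1⟩, rfl⟩
    exact ⟨x.2, h0, h1⟩

lemma IsNeumann.numOfOrder_add_eq_top (hN : IsNeumann Shat) {X : Set Shat}
    (hX : IsIndependentGenerators X) :
    numOfOrder X 2 + numOfOrder X 3 + numOfOrder X 0 = ⊤ := by
  by_contra hne
  have hfin : X.Finite := by
    rw [← Set.encard_ne_top_iff]
    refine ne_top_of_le_ne_top hne ?_
    have h1 : X ⊆ {x ∈ X | orderOf x = 2} ∪ {x ∈ X | orderOf x = 3} ∪
        {x ∈ X | orderOf x = 0} := fun x hx => by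
      rcases hX.order x hx with h | h | h
      exacts [Or.inl (Or.inl ⟨hx, h⟩), Or.inl (Or.inr ⟨hx, h⟩), Or.inr ⟨hx, h⟩]
    exact (Set.encard_le_encard h1).trans ((Set.encard_union_le _ _).trans
      (add_le_add_left (Set.encard_union_le _ _) _))
  have hcl := hX.isFreeFamily.closure_range
  rw [Subtype.range_coe] at hcl
  exact hN.not_fg hfin hcl

lemma IsNeumann.isElliptic_of_mem (hN : IsNeumann Shat) {X : Set Shat}
    (hX : IsIndependentGenerators X) {x : Shat} (hx : x ∈ X) (h0 : orderOf x ≠ 0) :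
    IsElliptic (x : PGL(2, ℤ)) :=
  hN.isElliptic ((or_assoc.2 (hX.order x hx)).resolve_right h0)

lemma IsNeumann.one_le_numFreeOfDet (hN : IsNeumann Shat) (hM : ¬ Shat ≤ modularGroup)
    {X : Set Shat} (hX : IsIndependentGenerators X) : 1 ≤ numFreeOfDet X (-1) := by
  obtain ⟨x, hx⟩ := hX.isFreeFamily.exists_neg (sign_ne_one hM)
  have h0 := hX.isFreeFamily.eq_zero_of_neg (fun x => hX.order x x.2)
    (fun _ => hN.det_eq_one_of_orderOf) hx
  rw [numFreeOfDet_eq_encard, Set.one_le_encard_iff_nonempty]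
  exact ⟨x, h0, hx⟩

/-- A Neumann subgroup outside the modular group has a system of independent generators in which
only finitely many have determinant `-1`, and the number of the other free ones is even or
infinite. -/
lemma IsNeumann.exists_isIndependentGenerators (hN : IsNeumann Shat)
    (hM : ¬ Shat ≤ modularGroup) :
    ∃ X : Set Shat, IsIndependentGenerators X ∧ numFreeOfDet X (-1) ≠ ⊤ ∧
      numOfOrder X 0 = numFreeOfDet X (-1) + numFreeOfDet X 1 ∧
      ∀ k : ℕ, numFreeOfDet X 1 = k → Even k := by
  classical
  obtain ⟨J, x, n, hx, hn⟩ := hN.isFlagSystem.exists_isFreeFamily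
  have htor : ∀ g : Shat, orderOf g = 2 → sign Shat g = 1 := fun _ => hN.det_eq_one_of_orderOf
  obtain ⟨i₀, hi₀⟩ := hx.exists_neg (sign_ne_one hM)
  obtain ⟨B, hBZ, hi₀B, hB, heven⟩ := exists_finite_subset_even_diff (Z := {i | n i = 0})
    (hx.eq_zero_of_neg hn htor hi₀)
  obtain ⟨y, hy, hσ⟩ := hx.exists_sign hn htor hi₀ (fun i => if i ∈ B then -1 else 1)
    (by simp [hi₀B]) (fun i hi => if_neg fun h => hi (hBZ h))
  have hn1 : ∀ i, n i ≠ 1 := fun i => by have := hn i; omega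
  have hinj := hy.injective hn1
  have count : ∀ ε, numFreeOfDet (Set.range y) ε = {i | n i = 0 ∧ sign Shat (y i) = ε}.encard := by
    intro ε
    rw [← hinj.encard_image, numFreeOfDet]
    congr 1
    ext z
    constructor
    · rintro ⟨⟨i, rfl⟩, h1, h2⟩
      exact ⟨i, ⟨by rw [← hy.orderOf_eq, h1], h2⟩, rfl⟩
    · rintro ⟨i, ⟨h1, h2⟩, rfl⟩
      exact ⟨⟨i, rfl⟩, by rw [hy.orderOf_eq, h1], h2⟩
  have hneg : numFreeOfDet (Set.range y) (-1) = B.encard := by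
    rw [count]
    congr 1
    ext i
    by_cases hi : i ∈ B
    · simpa [hσ, hi] using hBZ hi
    · have : (1 : ℤˣ) ≠ -1 := by decide
      simp [hσ, hi, this]
  have hpos : numFreeOfDet (Set.range y) 1 = ({i | n i = 0} \ B).encard := by
    rw [count]
    congr 1
    ext i
    by_cases hi : i ∈ B
    · have : (-1 : ℤˣ) ≠ 1 := by decide
      simp [hσ, hi, this]
    · simp [hσ, hi]
  refine ⟨_, hy.isIndependentGenerators hn, ?_, ?_, ?_⟩
  · rw [hneg]
    exact hB.encard_lt_top.ne
  · rw [hneg, hpos, hy.numOfOrder_range hn1 0, add_comm, Set.encard_sdiff_add_encard_of_subset hBZ]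
  · intro k hk
    exact heven k (by rw [← hpos, hk])

end ExtModular

theorem theorem3p2 (Shat : Subgroup PGL(2, ℤ)) (hN : ExtModular.IsNeumann Shat)
    (hM : ¬ Shat ≤ ExtModular.modularGroup)
    (S : Subgroup PGL(2, ℤ)) (hS : S = Shat ⊓ ExtModular.modularGroup) :
    -- `S` is normal in `Shat` with quotient `C₂`
    (∃ _ : (S.subgroupOf Shat).Normal,
      Nonempty ((Shat ⧸ S.subgroupOf Shat) ≃* Multiplicative (ZMod 2))) ∧
    -- `Shat` is not a semidirect product of `S` and a subgroup isomorphic to `C₂`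
    (¬ ∃ C : Subgroup Shat, Nonempty (C ≃* Multiplicative (ZMod 2)) ∧
      Subgroup.IsComplement' (S.subgroupOf Shat) C) ∧
    -- `Shat` has a system of independent generators whose numbers satisfy all the conditions
    (∃ X : Set Shat, ExtModular.IsIndependentGenerators X ∧
      ExtModular.numOfOrder X 2 + ExtModular.numOfOrder X 3 + ExtModular.numOfOrder X 0 = ⊤ ∧
      1 ≤ ExtModular.numFreeOfDet X (-1) ∧
      (∀ n : ℕ, ExtModular.numFreeOfDet X 1 = n → Even n) ∧
      2 * ExtModular.numFreeOfDet X (-1) ≤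
        2 * ExtModular.numOfOrder X 2 + 2 * ExtModular.numOfOrder X 3 +
          ExtModular.numFreeOfDet X 1 ∧
      (∀ x ∈ X, orderOf x ≠ 0 → ExtModular.IsElliptic (x : PGL(2, ℤ)))) ∧
    -- the conditions that do not depend on the choice of the independent generators,
    -- and the structure of `S`
    (∀ X : Set Shat, ExtModular.IsIndependentGenerators X →
      ExtModular.numOfOrder X 2 + ExtModular.numOfOrder X 3 + ExtModular.numOfOrder X 0 = ⊤ ∧
      1 ≤ ExtModular.numFreeOfDet X (-1) ∧
      (∀ x ∈ X, orderOf x ≠ 0 → ExtModular.IsElliptic (x : PGL(2, ℤ))) ∧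
      ExtModular.HasStructure S (2 * ExtModular.numOfOrder X 2) (2 * ExtModular.numOfOrder X 3)
        (2 * ExtModular.numOfOrder X 0 - 1) ∧
      ∀ r₂ r₃ rinf : ℕ∞, ExtModular.HasStructure S r₂ r₃ rinf →
        r₂ = 2 * ExtModular.numOfOrder X 2 ∧ r₃ = 2 * ExtModular.numOfOrder X 3 ∧
          rinf = 2 * ExtModular.numOfOrder X 0 - 1) := by
  have hd := ExtModular.sign_ne_one hM
  have htor : ∀ g : Shat, orderOf g = 2 → ExtModular.sign Shat g = 1 :=
    fun _ => hN.det_eq_one_of_orderOf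
  have hker : S.subgroupOf Shat = (ExtModular.sign Shat).ker := by
    rw [hS, ExtModular.subgroupOf_eq_ker_sign]
  have hle : S ≤ Shat := hS ▸ inf_le_left
  refine ⟨?_, ?_, ?_, ?_⟩
  · rw [hker]
    exact ⟨inferInstance, ExtModular.nonempty_quotient_ker_mulEquiv hd⟩
  · rintro ⟨C, ⟨e⟩, hC⟩
    rw [hker] at hC
    exact ExtModular.not_isComplement'_ker htor e hC
  · obtain ⟨X, hX, hfin, hadd, heven⟩ := hN.exists_isIndependentGenerators hM
    have htop := hN.numOfOrder_add_eq_top hX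
    refine ⟨X, hX, htop, hN.one_le_numFreeOfDet hM hX, heven, ?_,
      fun x hx h0 => hN.isElliptic_of_mem hX hx h0⟩
    -- only finitely many generators have determinant `-1`, so the right-hand side is infinite
    rw [hadd] at htop
    have h2 : (2 : ℕ∞) ≠ 0 := by norm_num
    simp only [ENat.add_eq_top, hfin, false_or] at htop
    rcases htop with (h | h) | h <;> simp [h, ENat.mul_top h2]
  · intro X hX
    have hstruct : ExtModular.HasStructure S (2 * ExtModular.numOfOrder X 2)
        (2 * ExtModular.numOfOrder X 3) (2 * ExtModular.numOfOrder X 0 - 1) := by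
      have h := hX.isFreeFamily.hasStructure_ker (fun x => hX.order x x.2) hd htor
      simp only [ExtModular.numOfOrder_eq_encard]
      exact h.of_mulEquiv
        ((MulEquiv.subgroupCongr hker.symm).trans (Subgroup.subgroupOfEquivOfLe hle))
    exact ⟨hN.numOfOrder_add_eq_top hX, hN.one_le_numFreeOfDet hM hX,
      fun x hx h0 => hN.isElliptic_of_mem hX hx h0, hstruct, fun r₂ r₃ rinf h => h.unique hstruct⟩
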